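/- Let $T$ be a dependent type theory: a formal system, over a signature of type and term constructors (possibly binding variables), for deriving judgements $A \in \mathrm{Type}$, $a \in A$, $A = B \in \mathrm{Type}$, $a = b \in A$ in well-formed contexts $\Gamma = [x_0 \in A_0, \ldots, x_{n-1} \in A_{n-1}]$. Its rules are the basic ones (variables, weakening, substitution, reflexivity, symmetry and transitivity of both definitional equalities, conversion, and congruence: all type and term expressions respect definitional equality), together with an arbitrary set of further rules. The classifying category of $T$ has as objects the well-formed contexts, where contexts of the same length are identified if their types are successively definitionally equal. A morphism $\Delta \to \Gamma$, with $\Gamma$ as above, is a tuple of terms $(t_0,\ldots,t_{n-1})$ with $t_i \in A_i(t_0,\ldots,t_{i-1})\ [\Delta]$ for all $i$, up to termwise definitional equality; composition is substitution. A display map is a morphism $[\Gamma, x \in A] \to [\Gamma]$ that drops the last type of a context; a dependent projection is a morphism $[\Gamma,\Delta] \to [\Gamma]$ that drops a (possibly empty) final segment; a fibration is a morphism that is isomorphic, in the arrow category, to a dependent projection. Suppose that $T$ has strong sums, i.e. it contains, with congruence rules for all the constructors involved: - a type $1$ with a term $* \in 1$ such that $a = * \in 1$ for all $a \in 1$; -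 for $A \in \mathrm{Type}$ and $B \in \mathrm{Type}\ [x \in A]$ a type $\Sigma x \in A.\,B$, with pairs $\mathbf{p}ab \in \Sigma x\in A.\,B$ for $a \in A$ and $b \in B[a/x]$, and projections $\mathbf{p}_0 c \in A$ and $\mathbf{p}_1 c \in B[\mathbf{p}_0c/x]$ for $c \in \Sigma x \in A.\,B$, satisfying the definitional equalities $\mathbf{p}_0(\mathbf{p}ab) = a$, $\mathbf{p}_1(\mathbf{p}ab) = b$ and $\mathbf{p}(\mathbf{p}_0c)(\mathbf{p}_1c) = c$. Then every fibration in the classifying category of $T$ is isomorphic, in the arrow category, to a display map. -/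

import Mathlib

open CategoryTheory

universe u

namespace DTT

/-! ### Raw expressions

Expressions are well-scoped and nameless: an expression in scope `n` has its free variables among
`var 0, …, var (n - 1)`, where `var 0` is the variable declared last. -/

/-- The two kinds of expressions: type expressions and term expressions. -/
inductive Kind where
  | ty
  | tm

/-- The arity of a constructor: for every argument, its kind and the number of variables that the
constructor binds in it. -/
abbrev Arity := List (Kind × ℕ)

/-- A signature: arbitrary type constructors and term constructors, possibly binding variables. -/
structure Signature where
  Con : Kind → Type u
  arity : {k : Kind} → Con k → Arity

/-- Raw type and term expressions with `n` free variables. -/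
inductive Expr (S : Signature.{u}) : Kind → ℕ → Type u where
  | var {n : ℕ} (i : Fin n) : Expr S .tm n
  | con {k : Kind} {n : ℕ} (c : S.Con k)
      (args : ∀ i : Fin (S.arity c).length,
        Expr S ((S.arity c).get i).1 (n + ((S.arity c).get i).2)) : Expr S k n

abbrev Ty (S : Signature.{u}) (n : ℕ) := Expr S .ty n

abbrev Tm (S : Signature.{u}) (n : ℕ) := Expr S .tm n

/-- A tuple of `n` terms in scope `k`. -/
abbrev Sub (S : Signature.{u}) (n k : ℕ) := Fin n → Tm S k

/-- Extension of a renaming of variables under one binder. -/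
def liftRen {n k : ℕ} (ρ : Fin n → Fin k) : Fin (n + 1) → Fin (k + 1) :=
  Fin.cases 0 (fun i => (ρ i).succ)

/-- Extension of a renaming of variables under `m` binders. -/
def liftRenN {n k : ℕ} (ρ : Fin n → Fin k) : (m : ℕ) → Fin (n + m) → Fin (k + m)
  | 0 => ρ
  | m + 1 => liftRen (liftRenN ρ m)

variable {S : Signature.{u}}

/-- Renaming of variables. -/
def Expr.ren {κ : Kind} {n : ℕ} (e : Expr S κ n) : {k : ℕ} → (Fin n → Fin k) → Expr S κ k :=
  match e with
  | .var i => fun ρ => .var (ρ i)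
  | .con c args => fun ρ => .con c (fun i => (args i).ren (liftRenN ρ _))

/-- The same expression in a scope with one more variable, declared last. -/
abbrev Expr.wk {κ : Kind} {n : ℕ} (e : Expr S κ n) : Expr S κ (n + 1) := e.ren Fin.succ

/-- Extension of a substitution under one binder. -/
def Sub.lift {n k : ℕ} (σ : Sub S n k) : Sub S (n + 1) (k + 1) :=
  Fin.cases (.var 0) (fun i => (σ i).wk)

/-- Extension of a substitution under `m` binders. -/
def Sub.liftN {n k : ℕ} (σ : Sub S n k) : (m : ℕ) → Sub S (n + m) (k + m)
  | 0 => σ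
  | m + 1 => (Sub.liftN σ m).lift

/-- Simultaneous capture-avoiding substitution. -/
def Expr.sub {κ : Kind} {n : ℕ} (e : Expr S κ n) : {k : ℕ} → Sub S n k → Expr S κ k :=
  match e with
  | .var i => fun σ => σ i
  | .con c args => fun σ => .con c (fun i => (args i).sub (σ.liftN _))

/-- The substitution `[a / x]` for the variable `x` declared last. -/
def Sub.inst {n : ℕ} (a : Tm S n) : Sub S (n + 1) n := Fin.cases a Expr.var

/-- The tuple of all variables. -/
def Sub.id (n : ℕ) : Sub S n n := Expr.var

/-- Composition of tuples: first `σ`, then `τ`, i.e. `τ` with `σ` substituted for its variables. -/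
def Sub.comp {n m k : ℕ} (σ : Sub S m k) (τ : Sub S n m) : Sub S n k := fun i => (τ i).sub σ

/-- The tuple `(x₀, …, xₙ₋₁)` of the first `n` variables, in a scope with `m` more variables. -/
def Sub.drop (n : ℕ) : (m : ℕ) → Sub S n (n + m)
  | 0 => Sub.id n
  | m + 1 => fun i => (Sub.drop n m i).wk

/-! ### Contexts and judgements -/

/-- Raw contexts of length `n`; the last type is added by `snoc`. -/
inductive Ctx (S : Signature.{u}) : ℕ → Type u where
  | nil : Ctx S 0
  | snoc {n : ℕ} (Γ : Ctx S n) (A : Ty S n) : Ctx S (n + 1)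

/-- Raw final segments, of length `m`, of a context whose initial segment has length `n`. -/
inductive Tel (S : Signature.{u}) (n : ℕ) : ℕ → Type u where
  | nil : Tel S n 0
  | snoc {m : ℕ} (Δ : Tel S n m) (A : Ty S (n + m)) : Tel S n (m + 1)

/-- The context `[Γ, Δ]`. -/
def Ctx.append {n : ℕ} (Γ : Ctx S n) : {m : ℕ} → Tel S n m → Ctx S (n + m)
  | _, .nil => Γ
  | _, .snoc Δ A => (Γ.append Δ).snoc A

def Tel.ren {n k : ℕ} (ρ : Fin n → Fin k) : {m : ℕ} → Tel S n m → Tel S k m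
  | _, .nil => .nil
  | _, .snoc (m := m) Δ A => .snoc (Δ.ren ρ) (A.ren (liftRenN ρ m))

def Tel.sub {n k : ℕ} (σ : Sub S n k) : {m : ℕ} → Tel S n m → Tel S k m
  | _, .nil => .nil
  | _, .snoc (m := m) Δ A => .snoc (Δ.sub σ) (A.sub (σ.liftN m))

/-- The type of the variable `i` in the context `Γ`, as an expression in the scope of `Γ`. -/
def Ctx.get : {n : ℕ} → Ctx S n → Fin n → Ty S n
  | _, .nil => fun i => i.elim0
  | _, .snoc Γ A => Fin.cases A.wk (fun i => (Γ.get i).wk)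

/-- The four forms of judgement, in scope `n`:
`A ∈ Type`, `a ∈ A`, `A = B ∈ Type` and `a = b ∈ A`. -/
inductive Jdg (S : Signature.{u}) (n : ℕ) : Type u where
  | isTy (A : Ty S n)
  | hasTy (a : Tm S n) (A : Ty S n)
  | tyEq (A B : Ty S n)
  | tmEq (a b : Tm S n) (A : Ty S n)

def Jdg.ren {n k : ℕ} (ρ : Fin n → Fin k) : Jdg S n → Jdg S k
  | .isTy A => .isTy (A.ren ρ)
  | .hasTy a A => .hasTy (a.ren ρ) (A.ren ρ)
  | .tyEq A B => .tyEq (A.ren ρ) (B.ren ρ)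
  | .tmEq a b A => .tmEq (a.ren ρ) (b.ren ρ) (A.ren ρ)

def Jdg.sub {n k : ℕ} (σ : Sub S n k) : Jdg S n → Jdg S k
  | .isTy A => .isTy (A.sub σ)
  | .hasTy a A => .hasTy (a.sub σ) (A.sub σ)
  | .tyEq A B => .tyEq (A.sub σ) (B.sub σ)
  | .tmEq a b A => .tmEq (a.sub σ) (b.sub σ) (A.sub σ)

/-- A judgement in context, `J [Γ]`. -/
structure Sequent (S : Signature.{u}) where
  {n : ℕ}
  ctx : Ctx S n
  jdg : Jdg S n

/-- The statements `Aᵢ ∈ Type [x₀ ∈ A₀, …, xᵢ₋₁ ∈ Aᵢ₋₁]`, for all types `Aᵢ` in the context. -/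
def Ctx.presup : {n : ℕ} → Ctx S n → List (Sequent S)
  | _, .nil => []
  | _, .snoc Γ A => ⟨Γ, .isTy A⟩ :: Γ.presup

/-! ### Type theories -/

/-- (An instance of) a rule: a finite list of premises and a conclusion. -/
structure Rule (S : Signature.{u}) where
  premises : List (Sequent S)
  concl : Sequent S

end DTT

open DTT in
/-- A dependent type theory is given by a signature and by an arbitrary set of (instances of) rules,
which are used in addition to the basic rules listed in `TypeTheory.Derivable`. -/
structure TypeTheory where
  sig : Signature.{u}
  rules : Set (Rule sig)

namespace TypeTheory

open DTT

/-- Derivability in a type theory: `T.Derivable Γ J` says that `J [Γ]` is derivable.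
The rules `replTy` and `replTm` say that all type and term expressions respect definitional
equality (this is the effect of the congruence rules for all constructors).
In `replTy`, `replTm` and `rule` it is required that the context of the conclusion is well-formed,
so that `J [Γ]` is derivable only if `Γ` is a well-formed context. -/
inductive Derivable (T : TypeTheory.{u}) : {n : ℕ} → Ctx T.sig n → Jdg T.sig n → Prop
  | var {n : ℕ} {Γ : Ctx T.sig n} {A : Ty T.sig n} :
      Derivable T Γ (.isTy A) → Derivable T (Γ.snoc A) (.hasTy (.var 0) A.wk)
  | weaken {n m : ℕ} {Γ : Ctx T.sig n} {Δ : Tel T.sig n m} {J : Jdg T.sig (n + m)}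
      {A : Ty T.sig n} :
      Derivable T (Γ.append Δ) J → Derivable T Γ (.isTy A) →
      Derivable T ((Γ.snoc A).append (Δ.ren Fin.succ)) (J.ren (liftRenN Fin.succ m))
  | subst {n m : ℕ} {Γ : Ctx T.sig n} {A : Ty T.sig n} {Δ : Tel T.sig (n + 1) m}
      {J : Jdg T.sig (n + 1 + m)} {a : Tm T.sig n} :
      Derivable T ((Γ.snoc A).append Δ) J → Derivable T Γ (.hasTy a A) →
      Derivable T (Γ.append (Δ.sub (Sub.inst a))) (J.sub ((Sub.inst a).liftN m))
  | tyRefl {n : ℕ} {Γ : Ctx T.sig n} {A : Ty T.sig n} :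
      Derivable T Γ (.isTy A) → Derivable T Γ (.tyEq A A)
  | tySymm {n : ℕ} {Γ : Ctx T.sig n} {A B : Ty T.sig n} :
      Derivable T Γ (.tyEq A B) → Derivable T Γ (.tyEq B A)
  | tyTrans {n : ℕ} {Γ : Ctx T.sig n} {A B C : Ty T.sig n} :
      Derivable T Γ (.tyEq A B) → Derivable T Γ (.tyEq B C) → Derivable T Γ (.tyEq A C)
  | tmRefl {n : ℕ} {Γ : Ctx T.sig n} {a : Tm T.sig n} {A : Ty T.sig n} :
      Derivable T Γ (.hasTy a A) → Derivable T Γ (.tmEq a a A)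
  | tmSymm {n : ℕ} {Γ : Ctx T.sig n} {a b : Tm T.sig n} {A : Ty T.sig n} :
      Derivable T Γ (.tmEq a b A) → Derivable T Γ (.tmEq b a A)
  | tmTrans {n : ℕ} {Γ : Ctx T.sig n} {a b c : Tm T.sig n} {A : Ty T.sig n} :
      Derivable T Γ (.tmEq a b A) → Derivable T Γ (.tmEq b c A) → Derivable T Γ (.tmEq a c A)
  | conv {n : ℕ} {Γ : Ctx T.sig n} {a : Tm T.sig n} {A B : Ty T.sig n} :
      Derivable T Γ (.hasTy a A) → Derivable T Γ (.tyEq A B) → Derivable T Γ (.hasTy a B)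
  | convEq {n : ℕ} {Γ : Ctx T.sig n} {a b : Tm T.sig n} {A B : Ty T.sig n} :
      Derivable T Γ (.tmEq a b A) → Derivable T Γ (.tyEq A B) → Derivable T Γ (.tmEq a b B)
  | replTy {n k : ℕ} {Γ : Ctx T.sig n} {Δ : Ctx T.sig k} {σ τ : Sub T.sig n k}
      {A : Ty T.sig n} :
      (∀ s ∈ Δ.presup, Derivable T s.ctx s.jdg) →
      (∀ i, Derivable T Δ (.hasTy (σ i) ((Γ.get i).sub σ))) →
      (∀ i, Derivable T Δ (.hasTy (τ i) ((Γ.get i).sub τ))) →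
      (∀ i, Derivable T Δ (.tmEq (σ i) (τ i) ((Γ.get i).sub σ))) →
      Derivable T Γ (.isTy A) → Derivable T Δ (.tyEq (A.sub σ) (A.sub τ))
  | replTm {n k : ℕ} {Γ : Ctx T.sig n} {Δ : Ctx T.sig k} {σ τ : Sub T.sig n k}
      {a : Tm T.sig n} {A : Ty T.sig n} :
      (∀ s ∈ Δ.presup, Derivable T s.ctx s.jdg) →
      (∀ i, Derivable T Δ (.hasTy (σ i) ((Γ.get i).sub σ))) →
      (∀ i, Derivable T Δ (.hasTy (τ i) ((Γ.get i).sub τ))) →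
      (∀ i, Derivable T Δ (.tmEq (σ i) (τ i) ((Γ.get i).sub σ))) →
      Derivable T Γ (.hasTy a A) → Derivable T Δ (.tmEq (a.sub σ) (a.sub τ) (A.sub σ))
  | rule (r : Rule T.sig) :
      r ∈ T.rules → (∀ s ∈ r.premises, Derivable T s.ctx s.jdg) →
      (∀ s ∈ r.concl.ctx.presup, Derivable T s.ctx s.jdg) → Derivable T r.concl.ctx r.concl.jdg

variable {T : TypeTheory.{u}}

/-- `Γ` is a well-formed context. -/
def IsCtx (T : TypeTheory.{u}) {n : ℕ} (Γ : Ctx T.sig n) : Prop :=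
  ∀ s ∈ Γ.presup, T.Derivable s.ctx s.jdg

/-- `(t₀, …, tₙ₋₁)` is a tuple of terms in context `Γ` with `tᵢ ∈ Aᵢ(t₀, …, tᵢ₋₁) [Γ]`, where
`Δ = [x₀ ∈ A₀, …, xₙ₋₁ ∈ Aₙ₋₁]`. -/
def IsSub (T : TypeTheory.{u}) {n k : ℕ} (Γ : Ctx T.sig k) (Δ : Ctx T.sig n)
    (t : Sub T.sig n k) : Prop :=
  ∀ i, T.Derivable Γ (.hasTy (t i) ((Δ.get i).sub t))

/-- `tᵢ = sᵢ ∈ Aᵢ(t₀, …, tᵢ₋₁) [Γ]` for all `i`, where `Δ = [x₀ ∈ A₀, …, xₙ₋₁ ∈ Aₙ₋₁]`. -/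
def SubEq (T : TypeTheory.{u}) {n k : ℕ} (Γ : Ctx T.sig k) (Δ : Ctx T.sig n)
    (t s : Sub T.sig n k) : Prop :=
  ∀ i, T.Derivable Γ (.tmEq (t i) (s i) ((Δ.get i).sub t))

/-- Contexts of the same length with `Aᵢ = Bᵢ ∈ Type [x₀ ∈ A₀, …, xᵢ₋₁ ∈ Aᵢ₋₁]` for all `i`. -/
def CtxEq (T : TypeTheory.{u}) : {n : ℕ} → Ctx T.sig n → Ctx T.sig n → Prop
  | _, .nil, .nil => True
  | _, .snoc Γ A, .snoc Γ' A' => CtxEq T Γ Γ' ∧ T.Derivable Γ (.tyEq A A')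

end TypeTheory

/-! ### Substitution lemmas -/

namespace DTT

variable {S : Signature.{u}}

theorem liftRenN_comp {n k l : ℕ} (ρ : Fin n → Fin k) (ρ' : Fin k → Fin l) (m : ℕ) :
    liftRenN ρ' m ∘ liftRenN ρ m = liftRenN (ρ' ∘ ρ) m := by
  induction m with
  | zero => rfl
  | succ m ih =>
    funext i
    refine Fin.cases rfl (fun i => ?_) i
    exact congrArg Fin.succ (congrFun ih i)

theorem Expr.ren_ren {κ : Kind} {n : ℕ} (e : Expr S κ n) : ∀ {k l : ℕ} (ρ : Fin n → Fin k)
    (ρ' : Fin k → Fin l), (e.ren ρ).ren ρ' = e.ren (ρ' ∘ ρ) := by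
  induction e with
  | var i => intros; rfl
  | con c args ih =>
    intro k l ρ ρ'
    simp only [Expr.ren, ih, liftRenN_comp]

theorem Expr.wk_ren {κ : Kind} {n k : ℕ} (e : Expr S κ n) (ρ : Fin n → Fin k) :
    e.wk.ren (liftRen ρ) = (e.ren ρ).wk := by
  unfold Expr.wk; rw [Expr.ren_ren, Expr.ren_ren]; rfl

theorem Sub.liftN_ren {n k l : ℕ} (ρ : Fin n → Fin k) (σ : Sub S k l) (m : ℕ) (i : Fin (n + m)) :
    σ.liftN m (liftRenN ρ m i) = Sub.liftN (fun j => σ (ρ j)) m i := by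
  induction m with
  | zero => rfl
  | succ m ih =>
    refine Fin.cases rfl (fun i => ?_) i
    exact congrArg Expr.wk (ih i)

theorem Expr.sub_ren {κ : Kind} {n : ℕ} (e : Expr S κ n) : ∀ {k l : ℕ} (ρ : Fin n → Fin k)
    (σ : Sub S k l), (e.ren ρ).sub σ = e.sub (fun i => σ (ρ i)) := by
  induction e with
  | var i => intros; rfl
  | con c args ih =>
    intro k l ρ σ
    simp only [Expr.ren, Expr.sub, ih, Sub.liftN_ren]

theorem Sub.ren_liftN {n k l : ℕ} (σ : Sub S n k) (ρ : Fin k → Fin l) (m : ℕ) (i : Fin (n + m)) :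
    (σ.liftN m i).ren (liftRenN ρ m) = Sub.liftN (fun j => (σ j).ren ρ) m i := by
  induction m with
  | zero => rfl
  | succ m ih =>
    refine Fin.cases rfl (fun i => ?_) i
    exact (Expr.wk_ren _ _).trans (congrArg Expr.wk (ih i))

theorem Expr.ren_sub {κ : Kind} {n : ℕ} (e : Expr S κ n) : ∀ {k l : ℕ} (σ : Sub S n k)
    (ρ : Fin k → Fin l), (e.sub σ).ren ρ = e.sub (fun i => (σ i).ren ρ) := by
  induction e with
  | var i => intros; rfl
  | con c args ih =>
    intro k l σ ρ
    simp only [Expr.ren, Expr.sub, ih, Sub.ren_liftN]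

theorem Expr.wk_sub_lift {κ : Kind} {n k : ℕ} (e : Expr S κ n) (σ : Sub S n k) :
    e.wk.sub σ.lift = (e.sub σ).wk := by
  unfold Expr.wk; rw [Expr.sub_ren, Expr.ren_sub]; rfl

theorem Expr.wk_sub {κ : Kind} {n k : ℕ} (e : Expr S κ n) (σ : Sub S (n + 1) k) :
    e.wk.sub σ = e.sub (fun i => σ i.succ) :=
  Expr.sub_ren _ _ _

theorem Sub.liftN_comp {n k l : ℕ} (σ : Sub S k l) (τ : Sub S n k) (m : ℕ) :
    (σ.liftN m).comp (τ.liftN m) = (σ.comp τ).liftN m := by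
  induction m with
  | zero => rfl
  | succ m ih =>
    funext i
    refine Fin.cases rfl (fun i => ?_) i
    exact (Expr.wk_sub_lift _ _).trans (congrArg Expr.wk (congrFun ih i))

theorem Sub.lift_comp {n k l : ℕ} (σ : Sub S k l) (τ : Sub S n k) :
    σ.lift.comp τ.lift = (σ.comp τ).lift :=
  Sub.liftN_comp σ τ 1

theorem Expr.sub_sub {κ : Kind} {n : ℕ} (e : Expr S κ n) : ∀ {k l : ℕ} (τ : Sub S n k)
    (σ : Sub S k l), (e.sub τ).sub σ = e.sub (σ.comp τ) := by
  induction e with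
  | var i => intros; rfl
  | con c args ih =>
    intro k l τ σ
    simp only [Expr.sub, ih, Sub.liftN_comp]

theorem Sub.lift_id (n : ℕ) : (Sub.id n : Sub S n n).lift = Sub.id (n + 1) := by
  funext i
  exact Fin.cases rfl (fun _ => rfl) i

theorem Sub.liftN_id (n m : ℕ) : (Sub.id n : Sub S n n).liftN m = Sub.id (n + m) := by
  induction m with
  | zero => rfl
  | succ m ih => exact (congrArg Sub.lift ih).trans (Sub.lift_id _)

theorem Expr.sub_id {κ : Kind} {n : ℕ} (e : Expr S κ n) : e.sub (Sub.id n) = e := by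
  induction e with
  | var i => rfl
  | con c args ih => simp only [Expr.sub, Sub.liftN_id, ih]

theorem liftN_var {n k : ℕ} (ρ : Fin n → Fin k) (m : ℕ) :
    Sub.liftN (S := S) (fun i => .var (ρ i)) m = fun i => .var (liftRenN ρ m i) := by
  induction m with
  | zero => rfl
  | succ m ih =>
    funext i
    refine Fin.cases rfl (fun i => ?_) i
    exact congrArg Expr.wk (congrFun ih i)

theorem Expr.ren_eq_sub {κ : Kind} {n : ℕ} (e : Expr S κ n) : ∀ {k : ℕ} (ρ : Fin n → Fin k),
    e.ren ρ = e.sub (fun i => .var (ρ i)) := by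
  induction e with
  | var i => intros; rfl
  | con c args ih =>
    intro k ρ
    simp only [Expr.ren, Expr.sub, ih, liftN_var]

theorem Sub.comp_id {n k : ℕ} (σ : Sub S n k) : σ.comp (Sub.id n) = σ := rfl

theorem Sub.id_comp {n k : ℕ} (σ : Sub S n k) : (Sub.id k).comp σ = σ := by
  funext i; exact Expr.sub_id _

theorem Sub.comp_assoc {n m k l : ℕ} (σ : Sub S k l) (τ : Sub S m k) (υ : Sub S n m) :
    (σ.comp τ).comp υ = σ.comp (τ.comp υ) := by
  funext i; exact (Expr.sub_sub _ _ _).symm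

theorem Jdg.sub_sub {n k l : ℕ} (J : Jdg S n) (τ : Sub S n k) (σ : Sub S k l) :
    (J.sub τ).sub σ = J.sub (σ.comp τ) := by
  cases J <;> simp [Jdg.sub, Expr.sub_sub]

theorem Jdg.sub_id {n : ℕ} (J : Jdg S n) : J.sub (Sub.id n) = J := by
  cases J <;> simp [Jdg.sub, Expr.sub_id]

theorem Jdg.ren_eq_sub {n k : ℕ} (J : Jdg S n) (ρ : Fin n → Fin k) :
    J.ren ρ = J.sub (fun i => .var (ρ i)) := by
  cases J <;> simp [Jdg.ren, Jdg.sub, Expr.ren_eq_sub]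

/-- `Lifts Γ Γ' σ Θ Θ' τ`: there is a final segment `Ξ` with `Θ = [Γ, Ξ]` and `Θ' = [Γ', Ξ(σ)]`,
and `τ` is `σ` extended by the variables of `Ξ`. -/
inductive Lifts {n k : ℕ} (Γ : Ctx S n) (Γ' : Ctx S k) (σ : Sub S n k) :
    {N K : ℕ} → Ctx S N → Ctx S K → Sub S N K → Prop
  | base : Lifts Γ Γ' σ Γ Γ' σ
  | lift {N K : ℕ} {Θ : Ctx S N} {Θ' : Ctx S K} {τ : Sub S N K} (B : Ty S N) :
      Lifts Γ Γ' σ Θ Θ' τ → Lifts Γ Γ' σ (Θ.snoc B) (Θ'.snoc (B.sub τ)) τ.lift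

theorem Lifts.factor {n m k : ℕ} {Γ : Ctx S n} {Γ' : Ctx S m} {Γ'' : Ctx S k} {τ : Sub S n m}
    {σ : Sub S m k} {N K : ℕ} {Θ : Ctx S N} {Θ'' : Ctx S K} {υ : Sub S N K}
    (h : Lifts Γ Γ'' (σ.comp τ) Θ Θ'' υ) : ∃ (M : ℕ) (Θ' : Ctx S M) (υ₁ : Sub S N M)
      (υ₂ : Sub S M K), Lifts Γ Γ' τ Θ Θ' υ₁ ∧ Lifts Γ' Γ'' σ Θ' Θ'' υ₂ ∧ υ = υ₂.comp υ₁ := by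
  induction h with
  | base => exact ⟨_, _, _, _, .base, .base, rfl⟩
  | lift B _ ih =>
    obtain ⟨M, Θ', υ₁, υ₂, h₁, h₂, rfl⟩ := ih
    refine ⟨_, _, _, _, .lift B h₁, ?_, (Sub.lift_comp _ _).symm⟩
    rw [← Expr.sub_sub]
    exact .lift _ h₂

/-- A pair of contexts together with a tuple of terms, all in bundled form. -/
structure SubPack (S : Signature.{u}) where
  {N K : ℕ}
  src : Ctx S N
  tgt : Ctx S K
  sub : Sub S N K

theorem Lifts.pack {n k : ℕ} {Γ : Ctx S n} {Γ' : Ctx S k} {σ : Sub S n k} {N K : ℕ}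
    {Θ : Ctx S N} {Θ' : Ctx S K} {τ : Sub S N K} (h : Lifts Γ Γ' σ Θ Θ' τ) :
    ∃ (m : ℕ) (Ξ : Tel S n m),
      (⟨Θ, Θ', τ⟩ : SubPack S) = ⟨Γ.append Ξ, Γ'.append (Ξ.sub σ), σ.liftN m⟩ := by
  induction h with
  | base => exact ⟨0, .nil, rfl⟩
  | lift B _ ih =>
    obtain ⟨m, Ξ, h⟩ := ih
    cases h
    exact ⟨m + 1, .snoc Ξ B, rfl⟩

theorem Tel.ren_eq_sub {n k m : ℕ} (Δ : Tel S n m) (ρ : Fin n → Fin k) :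
    Δ.ren ρ = Δ.sub (fun i => .var (ρ i)) := by
  induction Δ with
  | nil => rfl
  | snoc Δ A ih => simp [Tel.ren, Tel.sub, ih, Expr.ren_eq_sub, liftN_var]

theorem Tel.sub_id {n m : ℕ} (Δ : Tel S n m) : Δ.sub (Sub.id n) = Δ := by
  induction Δ with
  | nil => rfl
  | snoc Δ A ih => simp [Tel.sub, ih, Sub.liftN_id, Expr.sub_id]

end DTT

/-! ### Admissible rules -/

namespace TypeTheory

open DTT

variable {T : TypeTheory.{u}}

theorem isCtx_snoc {n : ℕ} {Γ : Ctx T.sig n} {A : Ty T.sig n} :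
    T.IsCtx (Γ.snoc A) ↔ T.Derivable Γ (.isTy A) ∧ T.IsCtx Γ := by
  simp [IsCtx, Ctx.presup]

theorem isCtx_nil : T.IsCtx (Ctx.nil : Ctx T.sig 0) := by
  simp [IsCtx, Ctx.presup]

theorem isCtx_weaken {n m : ℕ} {Γ : Ctx T.sig n} {A : Ty T.sig n} (hA : T.Derivable Γ (.isTy A))
    {Δ : Tel T.sig n m} (h : T.IsCtx (Γ.append Δ)) :
    T.IsCtx ((Γ.snoc A).append (Δ.ren Fin.succ)) := by
  induction Δ with
  | nil => exact isCtx_snoc.2 ⟨hA, h⟩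
  | snoc Δ B ih =>
    have h' := isCtx_snoc.1 h
    exact isCtx_snoc.2 ⟨.weaken h'.1 hA, ih h'.2⟩

theorem isCtx_subst {n m : ℕ} {Γ : Ctx T.sig n} {A : Ty T.sig n} {a : Tm T.sig n}
    (ha : T.Derivable Γ (.hasTy a A)) {Δ : Tel T.sig (n + 1) m}
    (h : T.IsCtx ((Γ.snoc A).append Δ)) : T.IsCtx (Γ.append (Δ.sub (Sub.inst a))) := by
  induction Δ with
  | nil => exact (isCtx_snoc.1 h).2
  | snoc Δ B ih =>
    have h' := isCtx_snoc.1 h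
    exact isCtx_snoc.2 ⟨.subst h'.1 ha, ih h'.2⟩

/-- `J [Γ]` is derivable only if `Γ` is a well-formed context. -/
theorem Derivable.isCtx {n : ℕ} {Γ : Ctx T.sig n} {J : Jdg T.sig n} (h : T.Derivable Γ J) :
    T.IsCtx Γ := by
  induction h with
  | var h ih => exact isCtx_snoc.2 ⟨h, ih⟩
  | weaken _ hA ih _ => exact isCtx_weaken hA ih
  | subst _ ha ih _ => exact isCtx_subst ha ih
  | replTy h => exact h
  | replTm h => exact h
  | rule r _ _ h => exact h
  | _ => assumption

/-- Derivability is preserved by the substitution `σ` in any initial segment. -/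
def Admits (T : TypeTheory.{u}) {n k : ℕ} (Γ : Ctx T.sig n) (Γ' : Ctx T.sig k)
    (σ : Sub T.sig n k) : Prop :=
  ∀ ⦃N K : ℕ⦄ ⦃Θ : Ctx T.sig N⦄ ⦃Θ' : Ctx T.sig K⦄ ⦃τ : Sub T.sig N K⦄,
    Lifts Γ Γ' σ Θ Θ' τ → ∀ J, T.Derivable Θ J → T.Derivable Θ' (J.sub τ)

theorem Admits.comp {n m k : ℕ} {Γ : Ctx T.sig n} {Γ' : Ctx T.sig m} {Γ'' : Ctx T.sig k}
    {τ : Sub T.sig n m} {σ : Sub T.sig m k} (hτ : T.Admits Γ Γ' τ) (hσ : T.Admits Γ' Γ'' σ) :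
    T.Admits Γ Γ'' (σ.comp τ) := by
  intro N K Θ Θ'' υ h J hJ
  obtain ⟨M, Θ', υ₁, υ₂, h₁, h₂, rfl⟩ := h.factor (Γ' := Γ')
  rw [← Jdg.sub_sub]
  exact hσ h₂ _ (hτ h₁ _ hJ)

theorem admits_inst {n : ℕ} {Γ : Ctx T.sig n} {A : Ty T.sig n} {a : Tm T.sig n}
    (ha : T.Derivable Γ (.hasTy a A)) : T.Admits (Γ.snoc A) Γ (Sub.inst a) := by
  intro N K Θ Θ' τ h J hJ
  obtain ⟨m, Ξ, h⟩ := h.pack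
  cases h
  exact .subst hJ ha

theorem admits_wk {n : ℕ} {Γ : Ctx T.sig n} {A : Ty T.sig n}
    (hA : T.Derivable Γ (.isTy A)) :
    T.Admits Γ (Γ.snoc A) (fun i => .var i.succ) := by
  intro N K Θ Θ' τ h J hJ
  obtain ⟨m, Ξ, h⟩ := h.pack
  cases h
  have := Derivable.weaken hJ hA
  rwa [Tel.ren_eq_sub, Jdg.ren_eq_sub, ← liftN_var] at this

theorem admits_id {n : ℕ} {Γ : Ctx T.sig n} : T.Admits Γ Γ (Sub.id n) := by
  intro N K Θ Θ' τ h J hJ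
  obtain ⟨m, Ξ, h⟩ := h.pack
  cases h
  rwa [Tel.sub_id, Sub.liftN_id, Jdg.sub_id]

theorem admits_nil {k : ℕ} {Γ : Ctx T.sig k} (hΓ : T.IsCtx Γ) (σ : Sub T.sig 0 k) :
    T.Admits .nil Γ σ := by
  induction Γ with
  | nil =>
    rw [Subsingleton.elim σ (Sub.id 0)]
    exact admits_id
  | snoc Γ A ih =>
    rw [isCtx_snoc] at hΓ
    rw [Subsingleton.elim σ (Sub.comp _ (fun i => i.elim0))]
    exact Admits.comp (ih hΓ.2 _) (admits_wk hΓ.1)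

theorem IsSub.tail {n k : ℕ} {Γ : Ctx T.sig n} {A : Ty T.sig n} {Γ' : Ctx T.sig k}
    {σ : Sub T.sig (n + 1) k} (h : T.IsSub Γ' (Γ.snoc A) σ) :
    T.IsSub Γ' Γ (fun i => σ i.succ) := by
  intro i
  have := h i.succ
  rwa [show (Γ.snoc A).get i.succ = (Γ.get i).wk from rfl, Expr.wk_sub] at this

theorem IsSub.head {n k : ℕ} {Γ : Ctx T.sig n} {A : Ty T.sig n} {Γ' : Ctx T.sig k}
    {σ : Sub T.sig (n + 1) k} (h : T.IsSub Γ' (Γ.snoc A) σ) :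
    T.Derivable Γ' (.hasTy (σ 0) (A.sub (fun i => σ i.succ))) := by
  have := h 0
  rwa [show (Γ.snoc A).get 0 = A.wk from rfl, Expr.wk_sub] at this

/-- Simultaneous substitution is admissible, also under a further final segment of the context. -/
theorem admits_of_isSub {n k : ℕ} {Γ : Ctx T.sig n} {Γ' : Ctx T.sig k} {σ : Sub T.sig n k}
    (hΓ' : T.IsCtx Γ') (h : T.IsSub Γ' Γ σ) : T.Admits Γ Γ' σ := by
  induction Γ with
  | nil => exact admits_nil hΓ' σ
  | snoc Γ A ih =>
    have h₁ := ih h.tail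
    have h₂ : T.Admits (Γ.snoc A) (Γ'.snoc (A.sub (fun i => σ i.succ)))
        (Sub.lift (fun i => σ i.succ)) := fun _ _ _ _ _ hl => by
      have key : ∀ {N K : ℕ} {Θ : Ctx T.sig N} {Θ' : Ctx T.sig K} {τ : Sub T.sig N K},
          Lifts (Γ.snoc A) (Γ'.snoc (A.sub (fun i => σ i.succ))) (Sub.lift (fun i => σ i.succ))
            Θ Θ' τ → Lifts Γ Γ' (fun i => σ i.succ) Θ Θ' τ := by
        intro N K Θ Θ' τ hl
        induction hl with
        | base => exact .lift _ .base
        | lift B _ ih => exact .lift _ ih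
      exact h₁ (key hl)
    have h₃ := Admits.comp h₂ (admits_inst h.head)
    have : (Sub.inst (σ 0)).comp (Sub.lift (fun i => σ i.succ)) = σ := by
      funext i
      refine Fin.cases rfl (fun i => ?_) i
      exact (Expr.wk_sub _ _).trans (Expr.sub_id _)
    rwa [this] at h₃

theorem Derivable.substitute {n k : ℕ} {Γ : Ctx T.sig n} {Γ' : Ctx T.sig k} {σ : Sub T.sig n k}
    {J : Jdg T.sig n} (hJ : T.Derivable Γ J) (hΓ' : T.IsCtx Γ') (h : T.IsSub Γ' Γ σ) :
    T.Derivable Γ' (J.sub σ) :=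
  admits_of_isSub hΓ' h .base J hJ

theorem Derivable.wk {n : ℕ} {Γ : Ctx T.sig n} {A : Ty T.sig n} {J : Jdg T.sig n}
    (hJ : T.Derivable Γ J) (hA : T.Derivable Γ (.isTy A)) :
    T.Derivable (Γ.snoc A) (J.ren Fin.succ) :=
  Derivable.weaken (Δ := .nil) hJ hA

theorem isSub_id {n : ℕ} {Γ : Ctx T.sig n} (hΓ : T.IsCtx Γ) : T.IsSub Γ Γ (Sub.id n) := by
  intro i
  rw [Expr.sub_id]
  induction Γ with
  | nil => exact i.elim0
  | snoc Γ A ih =>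
    rw [isCtx_snoc] at hΓ
    refine Fin.cases (.var hΓ.1) (fun i => ?_) i
    exact (ih hΓ.2 i).wk hΓ.1

theorem isTy_get {n : ℕ} {Γ : Ctx T.sig n} (hΓ : T.IsCtx Γ) (i : Fin n) :
    T.Derivable Γ (.isTy (Γ.get i)) := by
  induction Γ with
  | nil => exact i.elim0
  | snoc Γ A ih =>
    rw [isCtx_snoc] at hΓ
    exact Fin.cases (hΓ.1.wk hΓ.1) (fun i => (ih hΓ.2 i).wk hΓ.1) i

theorem isSub_drop_one {n : ℕ} {Γ : Ctx T.sig n} {A : Ty T.sig n} (h : T.IsCtx (Γ.snoc A)) :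
    T.IsSub (Γ.snoc A) Γ (fun i => .var i.succ) :=
  (isSub_id h).tail

theorem IsSub.comp {n m k : ℕ} {Γ : Ctx T.sig k} {Δ : Ctx T.sig m} {Θ : Ctx T.sig n}
    {σ : Sub T.sig m k} {τ : Sub T.sig n m} (hΓ : T.IsCtx Γ) (hσ : T.IsSub Γ Δ σ)
    (hτ : T.IsSub Δ Θ τ) : T.IsSub Γ Θ (σ.comp τ) := by
  intro i
  have := (hτ i).substitute hΓ hσ
  rwa [Jdg.sub, Expr.sub_sub] at this

theorem SubEq.refl {n k : ℕ} {Γ : Ctx T.sig k} {Δ : Ctx T.sig n} {σ : Sub T.sig n k}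
    (h : T.IsSub Γ Δ σ) : T.SubEq Γ Δ σ σ :=
  fun i => .tmRefl (h i)

theorem SubEq.get_eq {n k : ℕ} {Γ : Ctx T.sig k} {Δ : Ctx T.sig n} {σ τ : Sub T.sig n k}
    (hΓ : T.IsCtx Γ) (hΔ : T.IsCtx Δ) (hσ : T.IsSub Γ Δ σ) (hτ : T.IsSub Γ Δ τ)
    (h : T.SubEq Γ Δ σ τ) (i : Fin n) :
    T.Derivable Γ (.tyEq ((Δ.get i).sub σ) ((Δ.get i).sub τ)) :=
  .replTy hΓ hσ hτ h (isTy_get hΔ i)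

theorem SubEq.symm {n k : ℕ} {Γ : Ctx T.sig k} {Δ : Ctx T.sig n} {σ τ : Sub T.sig n k}
    (hΓ : T.IsCtx Γ) (hΔ : T.IsCtx Δ) (hσ : T.IsSub Γ Δ σ) (hτ : T.IsSub Γ Δ τ)
    (h : T.SubEq Γ Δ σ τ) : T.SubEq Γ Δ τ σ :=
  fun i => .convEq (.tmSymm (h i)) (h.get_eq hΓ hΔ hσ hτ i)

theorem SubEq.trans {n k : ℕ} {Γ : Ctx T.sig k} {Δ : Ctx T.sig n} {σ τ υ : Sub T.sig n k}
    (hΓ : T.IsCtx Γ) (hΔ : T.IsCtx Δ) (hσ : T.IsSub Γ Δ σ) (hτ : T.IsSub Γ Δ τ)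
    (h : T.SubEq Γ Δ σ τ) (h' : T.SubEq Γ Δ τ υ) : T.SubEq Γ Δ σ υ :=
  fun i => .tmTrans (h i) (.convEq (h' i) (.tySymm (h.get_eq hΓ hΔ hσ hτ i)))

theorem SubEq.comp {n m k : ℕ} {Γ : Ctx T.sig k} {Δ : Ctx T.sig m} {Θ : Ctx T.sig n}
    {σ σ' : Sub T.sig m k} {τ τ' : Sub T.sig n m} (hΓ : T.IsCtx Γ)
    (hΘ : T.IsCtx Θ) (hσ : T.IsSub Γ Δ σ) (hσ' : T.IsSub Γ Δ σ') (hτ : T.IsSub Δ Θ τ)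
    (hτ' : T.IsSub Δ Θ τ') (h : T.SubEq Γ Δ σ σ') (h' : T.SubEq Δ Θ τ τ') :
    T.SubEq Γ Θ (σ.comp τ) (σ'.comp τ') := by
  refine SubEq.trans hΓ hΘ (hσ.comp hΓ hτ) (τ := σ.comp τ') (hσ.comp hΓ hτ') ?_ ?_
  · intro i
    have := (h' i).substitute hΓ hσ
    rwa [Jdg.sub, Expr.sub_sub] at this
  · intro i
    have := Derivable.replTm hΓ hσ hσ' h (hτ' i)
    rwa [Expr.sub_sub] at this

/-- Equal contexts are related by the tuple of all variables. -/
theorem CtxEq.isSub {n : ℕ} {Γ Γ' : Ctx T.sig n} (hΓ' : T.IsCtx Γ')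
    (h : T.CtxEq Γ Γ') : T.IsSub Γ' Γ (Sub.id n) := by
  induction n with
  | zero => exact fun i => i.elim0
  | succ n ih =>
    obtain _ | ⟨Γ, A⟩ := Γ
    obtain _ | ⟨Γ', A'⟩ := Γ'
    obtain ⟨h, hA⟩ := h
    rw [isCtx_snoc] at hΓ'
    have hs := ih hΓ'.2 h
    intro i
    rw [Expr.sub_id]
    refine Fin.cases ?_ (fun i => ?_) i
    · have h₁ := hA.substitute hΓ'.2 hs
      rw [Jdg.sub, Expr.sub_id, Expr.sub_id] at h₁
      exact .conv (.var hΓ'.1) (h₁.tySymm.wk hΓ'.1)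
    · have h₁ := hs i
      rw [Expr.sub_id] at h₁
      exact h₁.wk hΓ'.1

theorem CtxEq.convert {n : ℕ} {Γ Γ' : Ctx T.sig n} (hΓ' : T.IsCtx Γ') (h : T.CtxEq Γ Γ')
    {J : Jdg T.sig n} (hJ : T.Derivable Γ J) : T.Derivable Γ' J := by
  have := hJ.substitute hΓ' (h.isSub hΓ')
  rwa [Jdg.sub_id] at this

theorem CtxEq.refl {n : ℕ} {Γ : Ctx T.sig n} (hΓ : T.IsCtx Γ) : T.CtxEq Γ Γ := by
  induction Γ with
  | nil => trivial
  | snoc Γ A ih =>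
    rw [isCtx_snoc] at hΓ
    exact ⟨ih hΓ.2, .tyRefl hΓ.1⟩

theorem CtxEq.symm {n : ℕ} {Γ Γ' : Ctx T.sig n} (hΓ' : T.IsCtx Γ') (h : T.CtxEq Γ Γ') :
    T.CtxEq Γ' Γ := by
  induction n with
  | zero =>
    obtain _ | _ := Γ
    obtain _ | _ := Γ'
    trivial
  | succ n ih =>
    obtain _ | ⟨Γ, A⟩ := Γ
    obtain _ | ⟨Γ', A'⟩ := Γ'
    rw [isCtx_snoc] at hΓ'
    exact ⟨ih hΓ'.2 h.1, (h.1.convert hΓ'.2 h.2).tySymm⟩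

theorem CtxEq.trans {n : ℕ} {Γ Γ' Γ'' : Ctx T.sig n} (hΓ : T.IsCtx Γ) (hΓ' : T.IsCtx Γ')
    (h : T.CtxEq Γ Γ') (h' : T.CtxEq Γ' Γ'') : T.CtxEq Γ Γ'' := by
  induction n with
  | zero =>
    obtain _ | _ := Γ
    obtain _ | _ := Γ''
    trivial
  | succ n ih =>
    obtain _ | ⟨Γ, A⟩ := Γ
    obtain _ | ⟨Γ', A'⟩ := Γ'
    obtain _ | ⟨Γ'', A''⟩ := Γ''
    rw [isCtx_snoc] at hΓ hΓ'
    exact ⟨ih hΓ.2 hΓ'.2 h.1 h'.1, h.2.tyTrans ((h.1.symm hΓ'.2).convert hΓ.2 h'.2)⟩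

theorem IsSub.convert {n k : ℕ} {Γ Γ' : Ctx T.sig k} {Δ Δ' : Ctx T.sig n} {σ : Sub T.sig n k}
    (hΓ' : T.IsCtx Γ') (hΔ : T.IsCtx Δ) (hΓΓ' : T.CtxEq Γ Γ')
    (hΔΔ' : T.CtxEq Δ Δ') (hΔ' : T.IsCtx Δ') (h : T.IsSub Γ Δ σ) : T.IsSub Γ' Δ' σ := by
  have h₁ : T.IsSub Γ' Δ σ := fun i => hΓΓ'.convert hΓ' (h i)
  exact IsSub.comp hΓ' h₁ ((hΔΔ'.symm hΔ').isSub hΔ)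

theorem SubEq.convert {n k : ℕ} {Γ Γ' : Ctx T.sig k} {Δ Δ' : Ctx T.sig n} {σ τ : Sub T.sig n k}
    (hΓ' : T.IsCtx Γ') (hΔ : T.IsCtx Δ) (hΔ' : T.IsCtx Δ') (hΓΓ' : T.CtxEq Γ Γ')
    (hΔΔ' : T.CtxEq Δ Δ') (hσ : T.IsSub Γ Δ σ) (hτ : T.IsSub Γ Δ τ) (h : T.SubEq Γ Δ σ τ) :
    T.SubEq Γ' Δ' σ τ := by
  have hσ' : T.IsSub Γ' Δ σ := fun i => hΓΓ'.convert hΓ' (hσ i)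
  have hτ' : T.IsSub Γ' Δ τ := fun i => hΓΓ'.convert hΓ' (hτ i)
  have h' : T.SubEq Γ' Δ σ τ := fun i => hΓΓ'.convert hΓ' (h i)
  have hid := (hΔΔ'.symm hΔ').isSub hΔ
  exact SubEq.comp hΓ' hΔ' hσ' hτ' hid hid h' (SubEq.refl hid)

/-! ### The classifying category -/

/-- Equality of well-formed contexts of length `n`. -/
instance ctxSetoid (T : TypeTheory.{u}) (n : ℕ) : Setoid {Γ : Ctx T.sig n // T.IsCtx Γ} where
  r Γ Γ' := T.CtxEq Γ.1 Γ'.1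
  iseqv :=
    ⟨fun Γ => .refl Γ.2, fun {_ Γ'} h => h.symm Γ'.2, fun {Γ Γ' _} h h' => h.trans Γ.2 Γ'.2 h'⟩

/-- Objects of the classifying category: equivalence classes of well-formed contexts of the same
length. -/
structure ClassifyingCategory (T : TypeTheory.{u}) where
  len : ℕ
  cls : Quotient (T.ctxSetoid len)

/-- The object given by a well-formed context. -/
def obj {n : ℕ} (Γ : Ctx T.sig n) (hΓ : T.IsCtx Γ) : ClassifyingCategory T where
  len := n
  cls := ⟦⟨Γ, hΓ⟩⟧

namespace ClassifyingCategory

theorem ind {p : ClassifyingCategory T → Prop}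
    (h : ∀ {n : ℕ} (Γ : Ctx T.sig n) (hΓ : T.IsCtx Γ), p (obj Γ hΓ)) (X : ClassifyingCategory T) :
    p X := by
  obtain ⟨n, X⟩ := X
  induction X using Quotient.ind with
  | _ Γ => exact h Γ.1 Γ.2

/-- A tuple of terms that represents a morphism `X ⟶ Y`: for contexts `Γ`, `Δ` that represent `X`
and `Y` (by `pre_obj_iff` below, it does not matter which), it is of type `Δ` in context `Γ`. -/
def IsPre (X Y : ClassifyingCategory T) (t : Sub T.sig Y.len X.len) : Prop :=
  ∃ Γ Δ, X.cls = ⟦Γ⟧ ∧ Y.cls = ⟦Δ⟧ ∧ T.IsSub Γ.1 Δ.1 t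

/-- Representatives of morphisms. -/
abbrev Pre (X Y : ClassifyingCategory T) := {t : Sub T.sig Y.len X.len // IsPre X Y t}

/-- Equality of representatives: termwise definitional equality. -/
def PreEq (X Y : ClassifyingCategory T) (t s : Sub T.sig Y.len X.len) : Prop :=
  ∃ Γ Δ, X.cls = ⟦Γ⟧ ∧ Y.cls = ⟦Δ⟧ ∧ T.SubEq Γ.1 Δ.1 t s

theorem pre_obj_iff {n k : ℕ} {Γ : Ctx T.sig k} {Δ : Ctx T.sig n} {hΓ : T.IsCtx Γ}
    {hΔ : T.IsCtx Δ} {t : Sub T.sig n k} :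
    IsPre (obj Γ hΓ) (obj Δ hΔ) t ↔ T.IsSub Γ Δ t := by
  constructor
  · rintro ⟨Γ', Δ', h₁, h₂, h⟩
    have h₁' : T.CtxEq Γ Γ'.1 := Quotient.exact h₁
    have h₂' : T.CtxEq Δ Δ'.1 := Quotient.exact h₂
    exact h.convert hΓ Δ'.2 (h₁'.symm Γ'.2) (h₂'.symm Δ'.2) hΔ
  · exact fun h => ⟨⟨Γ, hΓ⟩, ⟨Δ, hΔ⟩, rfl, rfl, h⟩

theorem preEq_obj_iff {n k : ℕ} {Γ : Ctx T.sig k} {Δ : Ctx T.sig n} {hΓ : T.IsCtx Γ}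
    {hΔ : T.IsCtx Δ} {t s : Sub T.sig n k} (ht : T.IsSub Γ Δ t) (hs : T.IsSub Γ Δ s) :
    PreEq (obj Γ hΓ) (obj Δ hΔ) t s ↔ T.SubEq Γ Δ t s := by
  constructor
  · rintro ⟨Γ', Δ', h₁, h₂, h⟩
    have h₁' : T.CtxEq Γ Γ'.1 := Quotient.exact h₁
    have h₂' : T.CtxEq Δ Δ'.1 := Quotient.exact h₂
    exact h.convert hΓ Δ'.2 hΔ (h₁'.symm Γ'.2) (h₂'.symm Δ'.2)
      (ht.convert Γ'.2 hΔ h₁' h₂' Δ'.2) (hs.convert Γ'.2 hΔ h₁' h₂' Δ'.2)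
  · exact fun h => ⟨⟨Γ, hΓ⟩, ⟨Δ, hΔ⟩, rfl, rfl, h⟩

theorem preEq_equivalence (X Y : ClassifyingCategory T) :
    Equivalence (fun t s : Pre X Y => PreEq X Y t.1 s.1) := by
  induction X using ind with
  | _ Γ hΓ =>
  induction Y using ind with
  | _ Δ hΔ =>
  refine ⟨fun t => ?_, fun {t s} h => ?_, fun {t s r} h h' => ?_⟩
  · have ht := pre_obj_iff.1 t.2
    exact (preEq_obj_iff ht ht).2 (.refl ht)
  · have ht := pre_obj_iff.1 t.2
    have hs := pre_obj_iff.1 s.2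
    exact (preEq_obj_iff hs ht).2 (((preEq_obj_iff ht hs).1 h).symm hΓ hΔ ht hs)
  · have ht := pre_obj_iff.1 t.2
    have hs := pre_obj_iff.1 s.2
    have hr := pre_obj_iff.1 r.2
    exact (preEq_obj_iff ht hr).2
      (((preEq_obj_iff ht hs).1 h).trans hΓ hΔ ht hs ((preEq_obj_iff hs hr).1 h'))

instance preSetoid (X Y : ClassifyingCategory T) : Setoid (Pre X Y) where
  r t s := PreEq X Y t.1 s.1
  iseqv := preEq_equivalence X Y

theorem isPre_id (X : ClassifyingCategory T) : IsPre X X (Sub.id X.len) := by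
  induction X using ind with
  | _ Γ hΓ => exact pre_obj_iff.2 (isSub_id hΓ)

theorem IsPre.comp {X Y Z : ClassifyingCategory T} {t : Sub T.sig Y.len X.len}
    {s : Sub T.sig Z.len Y.len} (ht : IsPre X Y t) (hs : IsPre Y Z s) :
    IsPre X Z (Sub.comp t s) := by
  induction X using ind with
  | _ Γ hΓ =>
  induction Y using ind with
  | _ Δ hΔ =>
  induction Z using ind with
  | _ Θ hΘ =>
  exact pre_obj_iff.2 (IsSub.comp hΓ (pre_obj_iff.1 ht) (pre_obj_iff.1 hs))

theorem PreEq.comp {X Y Z : ClassifyingCategory T} {t t' : Sub T.sig Y.len X.len}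
    {s s' : Sub T.sig Z.len Y.len} (ht : IsPre X Y t) (ht' : IsPre X Y t') (hs : IsPre Y Z s)
    (hs' : IsPre Y Z s') (h : PreEq X Y t t') (h' : PreEq Y Z s s') :
    PreEq X Z (Sub.comp t s) (Sub.comp t' s') := by
  induction X using ind with
  | _ Γ hΓ =>
  induction Y using ind with
  | _ Δ hΔ =>
  induction Z using ind with
  | _ Θ hΘ =>
  have ht₁ := pre_obj_iff.1 ht
  have ht₁' := pre_obj_iff.1 ht'
  have hs₁ := pre_obj_iff.1 hs
  have hs₁' := pre_obj_iff.1 hs'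
  exact (preEq_obj_iff (IsSub.comp hΓ ht₁ hs₁) (IsSub.comp hΓ ht₁' hs₁')).2
    (SubEq.comp hΓ hΘ ht₁ ht₁' hs₁ hs₁' ((preEq_obj_iff ht₁ ht₁').1 h)
      ((preEq_obj_iff hs₁ hs₁').1 h'))

/-- The classifying category; composition is given by substitution. -/
instance : Category.{u} (ClassifyingCategory T) where
  Hom X Y := Quotient (preSetoid X Y)
  id X := ⟦⟨Sub.id X.len, isPre_id X⟩⟧
  comp {X Y Z} f g := Quotient.map₂ (fun (t : Pre X Y) (s : Pre Y Z) =>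
      (⟨Sub.comp t.1 s.1, t.2.comp s.2⟩ : Pre X Z))
    (fun t t' h s s' h' => PreEq.comp t.2 t'.2 s.2 s'.2 h h') f g
  id_comp f := by
    induction f using Quotient.ind with
    | _ t => exact congrArg (Quotient.mk _) (Subtype.ext (Sub.id_comp t.1))
  comp_id f := by
    induction f using Quotient.ind with
    | _ t => exact congrArg (Quotient.mk _) (Subtype.ext (Sub.comp_id t.1))
  assoc f g h := by
    induction f using Quotient.ind with
    | _ t =>
    induction g using Quotient.ind with
    | _ s =>
    induction h using Quotient.ind with
    | _ r => exact congrArg (Quotient.mk _) (Subtype.ext (Sub.comp_assoc t.1 s.1 r.1))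

end ClassifyingCategory

/-- The morphism `[Γ] ⟶ [Δ]` represented by a tuple of terms. -/
def hom {n k : ℕ} {Γ : Ctx T.sig k} {Δ : Ctx T.sig n} (hΓ : T.IsCtx Γ) (hΔ : T.IsCtx Δ)
    (t : Sub T.sig n k) (ht : T.IsSub Γ Δ t) : obj Γ hΓ ⟶ obj Δ hΔ :=
  Quotient.mk (ClassifyingCategory.preSetoid (obj Γ hΓ) (obj Δ hΔ))
    ⟨t, ClassifyingCategory.pre_obj_iff.2 ht⟩

/-! ### Display maps, dependent projections and fibrations -/

theorem IsCtx.of_append {n m : ℕ} {Γ : Ctx T.sig n} {Δ : Tel T.sig n m}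
    (h : T.IsCtx (Γ.append Δ)) : T.IsCtx Γ := by
  induction Δ with
  | nil => exact h
  | snoc Δ A ih => exact ih (isCtx_snoc.1 h).2

theorem isSub_drop {n m : ℕ} {Γ : Ctx T.sig n} {Δ : Tel T.sig n m}
    (h : T.IsCtx (Γ.append Δ)) : T.IsSub (Γ.append Δ) Γ (Sub.drop n m) := by
  induction Δ with
  | nil => exact isSub_id h
  | snoc Δ A ih =>
    have h' := isCtx_snoc.1 h
    intro i
    have := (ih h'.2 i).wk h'.1
    rwa [Jdg.ren, Expr.ren_sub] at this

/-- The dependent projection `[Γ, Δ] ⟶ [Γ]`, dropping the final segment `Δ`. -/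
def projection {n m : ℕ} (Γ : Ctx T.sig n) (Δ : Tel T.sig n m) (h : T.IsCtx (Γ.append Δ)) :
    obj (Γ.append Δ) h ⟶ obj Γ h.of_append :=
  hom h h.of_append (Sub.drop n m) (isSub_drop h)

/-- The display map `[Γ, x ∈ A] ⟶ [Γ]`, dropping the last type. -/
def display {n : ℕ} (Γ : Ctx T.sig n) (A : Ty T.sig n) (h : T.IsCtx (Γ.snoc A)) :
    obj (Γ.snoc A) h ⟶ obj Γ (isCtx_snoc.1 h).2 :=
  projection Γ (.snoc .nil A) h

/-- The class of display maps. -/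
inductive displayMaps (T : TypeTheory.{u}) : MorphismProperty (ClassifyingCategory T)
  | mk {n : ℕ} (Γ : Ctx T.sig n) (A : Ty T.sig n) (h : T.IsCtx (Γ.snoc A)) :
      displayMaps T (display Γ A h)

/-- The class of dependent projections. -/
inductive dependentProjections (T : TypeTheory.{u}) : MorphismProperty (ClassifyingCategory T)
  | mk {n m : ℕ} (Γ : Ctx T.sig n) (Δ : Tel T.sig n m) (h : T.IsCtx (Γ.append Δ)) :
      dependentProjections T (projection Γ Δ h)

/-- Fibrations: the morphisms that are isomorphic (as arrows) to dependent projections. -/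
def fibrations (T : TypeTheory.{u}) : MorphismProperty (ClassifyingCategory T) :=
  (dependentProjections T).isoClosure

end TypeTheory

/-! ### Strong sums -/

namespace DTT

/-- The expression with constructor `c` of arity `l` and the given arguments. -/
def Expr.mk {S : Signature.{u}} {k : Kind} {n : ℕ} (c : S.Con k) {l : Arity} (h : S.arity c = l)
    (args : ∀ i : Fin l.length, Expr S (l.get i).1 (n + (l.get i).2)) : Expr S k n :=
  match l, h, args with
  | _, rfl, args => .con c args

/-- Constructors `1`, `*`, `Σ` (binding one variable in its second argument), `p`, `p₀`, `p₁`. -/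
structure SumSymbols (S : Signature.{u}) where
  oneCon : S.Con .ty
  starCon : S.Con .tm
  sigmaCon : S.Con .ty
  pairCon : S.Con .tm
  fstCon : S.Con .tm
  sndCon : S.Con .tm
  arity_one : S.arity oneCon = []
  arity_star : S.arity starCon = []
  arity_sigma : S.arity sigmaCon = [(.ty, 0), (.ty, 1)]
  arity_pair : S.arity pairCon = [(.tm, 0), (.tm, 0)]
  arity_fst : S.arity fstCon = [(.tm, 0)]
  arity_snd : S.arity sndCon = [(.tm, 0)]

namespace SumSymbols

variable {S : Signature.{u}} (s : SumSymbols S)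

/-- The type `1`. -/
def one (n : ℕ) : Ty S n := .mk s.oneCon s.arity_one (fun i => i.elim0)

/-- The term `*`. -/
def star (n : ℕ) : Tm S n := .mk s.starCon s.arity_star (fun i => i.elim0)

/-- The type `Σ x ∈ A. B`. -/
def sigma {n : ℕ} (A : Ty S n) (B : Ty S (n + 1)) : Ty S n :=
  .mk s.sigmaCon s.arity_sigma (fun | 0 => A | 1 => B)

/-- The term `p a b`. -/
def pair {n : ℕ} (a b : Tm S n) : Tm S n :=
  .mk s.pairCon s.arity_pair (fun | 0 => a | 1 => b)

/-- The term `p₀ c`. -/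
def fst {n : ℕ} (c : Tm S n) : Tm S n := .mk s.fstCon s.arity_fst (fun | 0 => c)

/-- The term `p₁ c`. -/
def snd {n : ℕ} (c : Tm S n) : Tm S n := .mk s.sndCon s.arity_snd (fun | 0 => c)

end SumSymbols

end DTT

namespace TypeTheory

open DTT

/-- A type theory has strong sums if it contains a unit type and strong `Σ`-types, together with the
congruence rules for their constructors. The premises include the presuppositions that are usually
left tacit, such as `A ∈ Type` and `B ∈ Type [x ∈ A]` in the rules about `Σ x ∈ A. B`. -/
structure StrongSums (T : TypeTheory.{u}) where
  sym : SumSymbols T.sig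
  one_form {n : ℕ} {Γ : Ctx T.sig n} : T.IsCtx Γ →
    T.Derivable Γ (.isTy (sym.one n))
  star_intro {n : ℕ} {Γ : Ctx T.sig n} : T.IsCtx Γ →
    T.Derivable Γ (.hasTy (sym.star n) (sym.one n))
  one_eta {n : ℕ} {Γ : Ctx T.sig n} {a : Tm T.sig n} :
    T.Derivable Γ (.hasTy a (sym.one n)) →
    T.Derivable Γ (.tmEq a (sym.star n) (sym.one n))
  sigma_form {n : ℕ} {Γ : Ctx T.sig n} {A : Ty T.sig n} {B : Ty T.sig (n + 1)} :
    T.Derivable Γ (.isTy A) → T.Derivable (Γ.snoc A) (.isTy B) →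
    T.Derivable Γ (.isTy (sym.sigma A B))
  pair_intro {n : ℕ} {Γ : Ctx T.sig n} {A : Ty T.sig n} {B : Ty T.sig (n + 1)} {a b : Tm T.sig n} :
    T.Derivable Γ (.isTy A) → T.Derivable (Γ.snoc A) (.isTy B) →
    T.Derivable Γ (.hasTy a A) → T.Derivable Γ (.hasTy b (B.sub (Sub.inst a))) →
    T.Derivable Γ (.hasTy (sym.pair a b) (sym.sigma A B))
  fst_elim {n : ℕ} {Γ : Ctx T.sig n} {A : Ty T.sig n} {B : Ty T.sig (n + 1)} {c : Tm T.sig n} :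
    T.Derivable Γ (.isTy A) → T.Derivable (Γ.snoc A) (.isTy B) →
    T.Derivable Γ (.hasTy c (sym.sigma A B)) →
    T.Derivable Γ (.hasTy (sym.fst c) A)
  snd_elim {n : ℕ} {Γ : Ctx T.sig n} {A : Ty T.sig n} {B : Ty T.sig (n + 1)} {c : Tm T.sig n} :
    T.Derivable Γ (.isTy A) → T.Derivable (Γ.snoc A) (.isTy B) →
    T.Derivable Γ (.hasTy c (sym.sigma A B)) →
    T.Derivable Γ (.hasTy (sym.snd c) (B.sub (Sub.inst (sym.fst c))))
  fst_pair {n : ℕ} {Γ : Ctx T.sig n} {A : Ty T.sig n} {B : Ty T.sig (n + 1)} {a b : Tm T.sig n} :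
    T.Derivable Γ (.isTy A) → T.Derivable (Γ.snoc A) (.isTy B) →
    T.Derivable Γ (.hasTy a A) → T.Derivable Γ (.hasTy b (B.sub (Sub.inst a))) →
    T.Derivable Γ (.tmEq (sym.fst (sym.pair a b)) a A)
  snd_pair {n : ℕ} {Γ : Ctx T.sig n} {A : Ty T.sig n} {B : Ty T.sig (n + 1)} {a b : Tm T.sig n} :
    T.Derivable Γ (.isTy A) → T.Derivable (Γ.snoc A) (.isTy B) →
    T.Derivable Γ (.hasTy a A) → T.Derivable Γ (.hasTy b (B.sub (Sub.inst a))) →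
    T.Derivable Γ (.tmEq (sym.snd (sym.pair a b)) b (B.sub (Sub.inst a)))
  pair_eta {n : ℕ} {Γ : Ctx T.sig n} {A : Ty T.sig n} {B : Ty T.sig (n + 1)} {c : Tm T.sig n} :
    T.Derivable Γ (.isTy A) → T.Derivable (Γ.snoc A) (.isTy B) →
    T.Derivable Γ (.hasTy c (sym.sigma A B)) →
    T.Derivable Γ (.tmEq (sym.pair (sym.fst c) (sym.snd c)) c (sym.sigma A B))
  sigma_congr {n : ℕ} {Γ : Ctx T.sig n} {A A' : Ty T.sig n} {B B' : Ty T.sig (n + 1)} :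
    T.Derivable Γ (.isTy A) → T.Derivable Γ (.isTy A') →
    T.Derivable (Γ.snoc A) (.isTy B) → T.Derivable (Γ.snoc A) (.isTy B') →
    T.Derivable Γ (.tyEq A A') → T.Derivable (Γ.snoc A) (.tyEq B B') →
    T.Derivable Γ (.tyEq (sym.sigma A B) (sym.sigma A' B'))
  pair_congr {n : ℕ} {Γ : Ctx T.sig n} {A : Ty T.sig n} {B : Ty T.sig (n + 1)}
      {a a' b b' : Tm T.sig n} :
    T.Derivable Γ (.isTy A) → T.Derivable (Γ.snoc A) (.isTy B) →
    T.Derivable Γ (.hasTy a A) → T.Derivable Γ (.hasTy a' A) →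
    T.Derivable Γ (.hasTy b (B.sub (Sub.inst a))) →
    T.Derivable Γ (.hasTy b' (B.sub (Sub.inst a))) →
    T.Derivable Γ (.tmEq a a' A) → T.Derivable Γ (.tmEq b b' (B.sub (Sub.inst a))) →
    T.Derivable Γ (.tmEq (sym.pair a b) (sym.pair a' b') (sym.sigma A B))
  fst_congr {n : ℕ} {Γ : Ctx T.sig n} {A : Ty T.sig n} {B : Ty T.sig (n + 1)} {c c' : Tm T.sig n} :
    T.Derivable Γ (.isTy A) → T.Derivable (Γ.snoc A) (.isTy B) →
    T.Derivable Γ (.hasTy c (sym.sigma A B)) → T.Derivable Γ (.hasTy c' (sym.sigma A B)) →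
    T.Derivable Γ (.tmEq c c' (sym.sigma A B)) →
    T.Derivable Γ (.tmEq (sym.fst c) (sym.fst c') A)
  snd_congr {n : ℕ} {Γ : Ctx T.sig n} {A : Ty T.sig n} {B : Ty T.sig (n + 1)} {c c' : Tm T.sig n} :
    T.Derivable Γ (.isTy A) → T.Derivable (Γ.snoc A) (.isTy B) →
    T.Derivable Γ (.hasTy c (sym.sigma A B)) → T.Derivable Γ (.hasTy c' (sym.sigma A B)) →
    T.Derivable Γ (.tmEq c c' (sym.sigma A B)) →
    T.Derivable Γ (.tmEq (sym.snd c) (sym.snd c') (B.sub (Sub.inst (sym.fst c))))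

end TypeTheory

/-!
Up to isomorphism, display maps contain the identities and are closed under composition: `1` makes
`[Γ, z ∈ 1] ⟶ [Γ]` an isomorphism, and `Σ x ∈ A. B` makes `[Γ, z ∈ Σ x ∈ A. B]` isomorphic to
`[Γ, x ∈ A, y ∈ B]` over `[Γ]`. To compose two morphisms that are only isomorphic to display maps,
one needs in addition that display maps are stable under pullback, so that the isomorphism between
the two middle contexts can be absorbed by reindexing. A dependent projection is a composite of
finitely many (possibly no) display maps, and is therefore isomorphic to a single one.
-/

namespace DTT

variable {S : Signature.{u}}

/-- The tuple `σ` extended by the term `a` for the variable declared last. -/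
def Sub.cons {n k : ℕ} (a : Tm S k) (σ : Sub S n k) : Sub S (n + 1) k := Fin.cases a σ

/-- The tuple `σ` without the term for the variable declared last. -/
abbrev Sub.tail {n k : ℕ} (σ : Sub S (n + 1) k) : Sub S n k := fun i => σ i.succ

theorem Sub.cons_zero_tail {n k : ℕ} (σ : Sub S (n + 1) k) : Sub.cons (σ 0) σ.tail = σ := by
  funext i
  exact Fin.cases rfl (fun _ => rfl) i

theorem Sub.comp_cons {n m k : ℕ} (σ : Sub S m k) (a : Tm S m) (τ : Sub S n m) :
    σ.comp (Sub.cons a τ) = Sub.cons (a.sub σ) (σ.comp τ) := by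
  funext i
  exact Fin.cases rfl (fun _ => rfl) i

theorem Sub.comp_lift {n m k : ℕ} (σ : Sub S (m + 1) k) (τ : Sub S n m) :
    σ.comp τ.lift = Sub.cons (σ 0) (σ.tail.comp τ) := by
  funext i
  exact Fin.cases rfl (fun i => Expr.wk_sub (τ i) σ) i

theorem Sub.drop_one_comp {n k : ℕ} (σ : Sub S n k) :
    (Sub.drop k 1).comp σ = fun i => (σ i).wk :=
  funext fun i => (Expr.ren_eq_sub (σ i) Fin.succ).symm

theorem Expr.sub_lift_inst {κ : Kind} {n k : ℕ} (e : Expr S κ (n + 1)) (σ : Sub S n k)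
    (a : Tm S k) : (e.sub σ.lift).sub (Sub.inst a) = e.sub (Sub.cons a σ) := by
  rw [Expr.sub_sub, Sub.comp_lift]
  exact congrArg (fun τ => e.sub (Sub.cons a τ)) (Sub.id_comp σ)

theorem Expr.mk_sub {κ : Kind} {n m : ℕ} (c : S.Con κ) {l : Arity} (h : S.arity c = l)
    (args : ∀ i : Fin l.length, Expr S (l.get i).1 (n + (l.get i).2)) (σ : Sub S n m) :
    (Expr.mk c h args).sub σ = Expr.mk c h (fun i => (args i).sub (σ.liftN _)) := by
  subst h
  rfl

namespace SumSymbols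

variable (s : SumSymbols S) {n m : ℕ}

theorem one_sub (σ : Sub S n m) : (s.one n).sub σ = s.one m :=
  (Expr.mk_sub ..).trans (congrArg (Expr.mk _ _) (funext fun i => i.elim0))

theorem star_sub (σ : Sub S n m) : (s.star n).sub σ = s.star m :=
  (Expr.mk_sub ..).trans (congrArg (Expr.mk _ _) (funext fun i => i.elim0))

theorem sigma_sub (A : Ty S n) (B : Ty S (n + 1)) (σ : Sub S n m) :
    (s.sigma A B).sub σ = s.sigma (A.sub σ) (B.sub σ.lift) :=
  (Expr.mk_sub ..).trans (congrArg (Expr.mk _ _) (funext fun | 0 => rfl | 1 => rfl))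

theorem pair_sub (a b : Tm S n) (σ : Sub S n m) :
    (s.pair a b).sub σ = s.pair (a.sub σ) (b.sub σ) :=
  (Expr.mk_sub ..).trans (congrArg (Expr.mk _ _) (funext fun | 0 => rfl | 1 => rfl))

theorem fst_sub (c : Tm S n) (σ : Sub S n m) : (s.fst c).sub σ = s.fst (c.sub σ) :=
  (Expr.mk_sub ..).trans (congrArg (Expr.mk _ _) (funext fun | 0 => rfl))

theorem snd_sub (c : Tm S n) (σ : Sub S n m) : (s.snd c).sub σ = s.snd (c.sub σ) :=
  (Expr.mk_sub ..).trans (congrArg (Expr.mk _ _) (funext fun | 0 => rfl))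

/-- The tuple `(x₀, …, xₙ₋₁, p x y)` of terms in the context `[Γ, x ∈ A, y ∈ B]`, where `Γ` has
length `n`: the map to `[Γ, z ∈ Σ x ∈ A. B]`. -/
def pairing (n : ℕ) : Sub S (n + 1) (n + 2) :=
  Sub.cons (s.pair (.var 1) (.var 0)) (Sub.drop n 2)

/-- The tuple `(x₀, …, xₙ₋₁, p₀ z, p₁ z)` of terms in the context `[Γ, z ∈ Σ x ∈ A. B]`, where `Γ`
has length `n`: the map to `[Γ, x ∈ A, y ∈ B]`. -/
def unpairing (n : ℕ) : Sub S (n + 2) (n + 1) :=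
  Sub.cons (s.snd (.var 0)) (Sub.cons (s.fst (.var 0)) (Sub.drop n 1))

theorem pairing_comp_unpairing (n : ℕ) :
    (s.pairing n).comp (s.unpairing n) =
      Sub.cons (s.snd (s.pair (.var 1) (.var 0)))
        (Sub.cons (s.fst (s.pair (.var 1) (.var 0))) (Sub.drop n 2)) := by
  rw [unpairing, Sub.comp_cons, Sub.comp_cons, snd_sub, fst_sub]
  rfl

theorem unpairing_comp_pairing (n : ℕ) :
    (s.unpairing n).comp (s.pairing n) =
      Sub.cons (s.pair (s.fst (.var 0)) (s.snd (.var 0))) (Sub.drop n 1) := by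
  rw [pairing, Sub.comp_cons, pair_sub]
  rfl

end SumSymbols

end DTT

namespace TypeTheory

open DTT Limits

variable {T : TypeTheory.{u}}

section Substitution

variable {n k : ℕ} {Γ : Ctx T.sig n} {Δ : Ctx T.sig k} {A : Ty T.sig n}

theorem isSub_snoc_iff {σ : Sub T.sig (n + 1) k} :
    T.IsSub Δ (Γ.snoc A) σ ↔
      T.IsSub Δ Γ σ.tail ∧ T.Derivable Δ (.hasTy (σ 0) (A.sub σ.tail)) := by
  simp only [IsSub, Fin.forall_fin_succ, Ctx.get, Fin.cases_zero, Fin.cases_succ, Expr.wk_sub,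
    and_comm]

theorem subEq_snoc_iff {σ τ : Sub T.sig (n + 1) k} :
    T.SubEq Δ (Γ.snoc A) σ τ ↔
      T.SubEq Δ Γ σ.tail τ.tail ∧ T.Derivable Δ (.tmEq (σ 0) (τ 0) (A.sub σ.tail)) := by
  simp only [SubEq, Fin.forall_fin_succ, Ctx.get, Fin.cases_zero, Fin.cases_succ, Expr.wk_sub,
    and_comm]

theorem Derivable.isTy_of_snoc {J : Jdg T.sig (n + 1)} (hJ : T.Derivable (Γ.snoc A) J) :
    T.Derivable Γ (.isTy A) :=
  (isCtx_snoc.1 hJ.isCtx).1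

theorem Derivable.isCtx_snoc (hA : T.Derivable Γ (.isTy A)) : T.IsCtx (Γ.snoc A) :=
  TypeTheory.isCtx_snoc.2 ⟨hA, hA.isCtx⟩

theorem Derivable.substitute_lift {J : Jdg T.sig (n + 1)} {σ : Sub T.sig n k}
    (hJ : T.Derivable (Γ.snoc A) J) (hΔ : T.IsCtx Δ) (hσ : T.IsSub Δ Γ σ) :
    T.Derivable (Δ.snoc (A.sub σ)) (J.sub σ.lift) :=
  admits_of_isSub hΔ hσ (.lift A .base) J hJ

theorem IsSub.lift {σ : Sub T.sig n k} (hσ : T.IsSub Δ Γ σ) (hΔ : T.IsCtx Δ)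
    (hA : T.Derivable Γ (.isTy A)) : T.IsSub (Δ.snoc (A.sub σ)) (Γ.snoc A) σ.lift := by
  intro i
  have h := (isSub_id hA.isCtx_snoc i).substitute_lift hΔ hσ
  rwa [Jdg.sub, Expr.sub_id] at h

theorem IsSub.wk {σ : Sub T.sig n k} (hσ : T.IsSub Δ Γ σ) {B : Ty T.sig k}
    (hB : T.Derivable Δ (.isTy B)) : T.IsSub (Δ.snoc B) Γ (fun i => (σ i).wk) := by
  rw [← Sub.drop_one_comp]
  exact (isSub_drop_one hB.isCtx_snoc).comp hB.isCtx_snoc hσ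

end Substitution

section Hom

variable {n k l : ℕ} {Γ : Ctx T.sig n} {Δ : Ctx T.sig k} {Θ : Ctx T.sig l}
  {hΓ : T.IsCtx Γ} {hΔ : T.IsCtx Δ} {hΘ : T.IsCtx Θ}

theorem hom_eq_hom_iff {t s : Sub T.sig k n} (ht : T.IsSub Γ Δ t) (hs : T.IsSub Γ Δ s) :
    hom hΓ hΔ t ht = hom hΓ hΔ s hs ↔ T.SubEq Γ Δ t s :=
  Quotient.eq.trans (ClassifyingCategory.preEq_obj_iff ht hs)

theorem exists_hom_eq (f : obj Γ hΓ ⟶ obj Δ hΔ) : ∃ t ht, hom hΓ hΔ t ht = f := by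
  obtain ⟨⟨t, ht⟩, rfl⟩ := Quotient.exists_rep f
  exact ⟨t, ClassifyingCategory.pre_obj_iff.1 ht, rfl⟩

theorem hom_comp_hom {t : Sub T.sig k n} {s : Sub T.sig l k} (ht : T.IsSub Γ Δ t)
    (hs : T.IsSub Δ Θ s) :
    hom hΓ hΔ t ht ≫ hom hΔ hΘ s hs = hom hΓ hΘ (t.comp s) (ht.comp hΓ hs) :=
  rfl

theorem hom_comp_display {A : Ty T.sig k} (hA : T.IsCtx (Δ.snoc A)) {t : Sub T.sig (k + 1) n}
    (ht : T.IsSub Γ (Δ.snoc A) t) :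
    hom hΓ hA t ht ≫ display Δ A hA =
      hom hΓ (isCtx_snoc.1 hA).2 t.tail (isSub_snoc_iff.1 ht).1 :=
  rfl

theorem display_comp_hom {A : Ty T.sig n} (hA : T.IsCtx (Γ.snoc A)) {t : Sub T.sig k n}
    (ht : T.IsSub Γ Δ t) :
    display Γ A hA ≫ hom (isCtx_snoc.1 hA).2 hΔ t ht =
      hom hA hΔ (fun i => (t i).wk) (ht.wk (isCtx_snoc.1 hA).1) := by
  refine (hom_comp_hom (isSub_drop_one hA) ht).trans ?_
  congr 1
  exact Sub.drop_one_comp t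

theorem projection_snoc {m : ℕ} {Ξ : Tel T.sig n m} {B : Ty T.sig (n + m)}
    (h : T.IsCtx (Γ.append (.snoc Ξ B))) :
    projection Γ (.snoc Ξ B) h =
      display (Γ.append Ξ) B h ≫ projection Γ Ξ (isCtx_snoc.1 h).2 :=
  (display_comp_hom h (isSub_drop (isCtx_snoc.1 h).2)).symm

end Hom

section Reindexing

variable {n k : ℕ} {Γ : Ctx T.sig n} {Δ : Ctx T.sig k} {A : Ty T.sig k} {t : Sub T.sig k n}
  {W : ClassifyingCategory T}

theorem hom_lift_comp_display (hΓ : T.IsCtx Γ) (hA : T.IsCtx (Δ.snoc A)) (ht : T.IsSub Γ Δ t)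
    (hAt : T.IsCtx (Γ.snoc (A.sub t))) :
    hom hAt hA t.lift (ht.lift hΓ (isCtx_snoc.1 hA).1) ≫ display Δ A hA =
      display Γ (A.sub t) hAt ≫ hom hΓ (isCtx_snoc.1 hA).2 t ht :=
  (hom_comp_display hA _).trans (display_comp_hom hAt ht).symm

theorem exists_comp_hom_lift_eq (hΓ : T.IsCtx Γ) (hA : T.IsCtx (Δ.snoc A)) (ht : T.IsSub Γ Δ t)
    (hAt : T.IsCtx (Γ.snoc (A.sub t))) (u : W ⟶ obj (Δ.snoc A) hA) (v : W ⟶ obj Γ hΓ)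
    (huv : u ≫ display Δ A hA = v ≫ hom hΓ (isCtx_snoc.1 hA).2 t ht) :
    ∃ w : W ⟶ obj (Γ.snoc (A.sub t)) hAt,
      w ≫ hom hAt hA t.lift (ht.lift hΓ (isCtx_snoc.1 hA).1) = u ∧
        w ≫ display Γ (A.sub t) hAt = v := by
  induction W using ClassifyingCategory.ind with
  | _ Θ hΘ =>
  obtain ⟨hAΔ, hΔ⟩ := isCtx_snoc.1 hA
  obtain ⟨u, hu, rfl⟩ := exists_hom_eq u
  obtain ⟨v, hv, rfl⟩ := exists_hom_eq v
  obtain ⟨hu_tail, hu_zero⟩ := isSub_snoc_iff.1 hu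
  have h_eq : T.SubEq Θ Δ u.tail (v.comp t) :=
    (hom_eq_hom_iff hu_tail (hv.comp hΘ ht)).1 huv
  have hw : T.IsSub Θ (Γ.snoc (A.sub t)) (Sub.cons (u 0) v) := by
    refine isSub_snoc_iff.2 ⟨hv, hu_zero.conv ?_⟩
    rw [Expr.sub_sub]
    exact .replTy hΘ hu_tail (hv.comp hΘ ht) h_eq hAΔ
  refine ⟨hom hΘ hAt _ hw, Eq.symm ?_, hom_comp_display hAt hw⟩
  refine (hom_eq_hom_iff hu (hw.comp hΘ (ht.lift hΓ hAΔ))).2 ?_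
  rw [Sub.comp_lift]
  exact subEq_snoc_iff.2 ⟨h_eq, .tmRefl hu_zero⟩

theorem eq_of_comp_hom_lift_eq (hΓ : T.IsCtx Γ) (hA : T.IsCtx (Δ.snoc A)) (ht : T.IsSub Γ Δ t)
    (hAt : T.IsCtx (Γ.snoc (A.sub t))) {w w' : W ⟶ obj (Γ.snoc (A.sub t)) hAt}
    (h_lift : w ≫ hom hAt hA t.lift (ht.lift hΓ (isCtx_snoc.1 hA).1) =
      w' ≫ hom hAt hA t.lift (ht.lift hΓ (isCtx_snoc.1 hA).1))
    (h_display : w ≫ display Γ (A.sub t) hAt = w' ≫ display Γ (A.sub t) hAt) : w = w' := by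
  induction W using ClassifyingCategory.ind with
  | _ Θ hΘ =>
  obtain ⟨w, hw, rfl⟩ := exists_hom_eq w
  obtain ⟨w', hw', rfl⟩ := exists_hom_eq w'
  have ht_lift := ht.lift hΓ (isCtx_snoc.1 hA).1
  have h_tail : T.SubEq Θ Γ w.tail w'.tail :=
    (hom_eq_hom_iff (isSub_snoc_iff.1 hw).1 (isSub_snoc_iff.1 hw').1).1 h_display
  have h_comp : T.SubEq Θ (Δ.snoc A) (w.comp t.lift) (w'.comp t.lift) :=
    (hom_eq_hom_iff (hw.comp hΘ ht_lift) (hw'.comp hΘ ht_lift)).1 h_lift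
  rw [Sub.comp_lift, Sub.comp_lift] at h_comp
  refine (hom_eq_hom_iff hw hw').2 (subEq_snoc_iff.2 ⟨h_tail, ?_⟩)
  rw [Expr.sub_sub]
  exact (subEq_snoc_iff.1 h_comp).2

theorem isPullback_display (hΓ : T.IsCtx Γ) (hA : T.IsCtx (Δ.snoc A)) (ht : T.IsSub Γ Δ t)
    (hAt : T.IsCtx (Γ.snoc (A.sub t))) :
    IsPullback (hom hAt hA t.lift (ht.lift hΓ (isCtx_snoc.1 hA).1)) (display Γ (A.sub t) hAt)
      (display Δ A hA) (hom hΓ (isCtx_snoc.1 hA).2 t ht) := by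
  have comm := hom_lift_comp_display hΓ hA ht hAt
  choose lift h_fst h_snd using
    fun s : PullbackCone (display Δ A hA) (hom hΓ (isCtx_snoc.1 hA).2 t ht) =>
      exists_comp_hom_lift_eq hΓ hA ht hAt s.fst s.snd s.condition
  exact ⟨⟨comm⟩, ⟨PullbackCone.IsLimit.mk comm lift h_fst h_snd fun s m hm_fst hm_snd =>
    eq_of_comp_hom_lift_eq hΓ hA ht hAt (hm_fst.trans (h_fst s).symm)
      (hm_snd.trans (h_snd s).symm)⟩⟩

end Reindexing

/-- The isomorphism between the codomains is absorbed by reindexing. -/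
theorem isoClosure_displayMaps_iff {n : ℕ} {Γ : Ctx T.sig n} {hΓ : T.IsCtx Γ}
    {X : ClassifyingCategory T} {f : X ⟶ obj Γ hΓ} :
    (displayMaps T).isoClosure f ↔ ∃ (A : Ty T.sig n) (hA : T.IsCtx (Γ.snoc A))
      (e : X ≅ obj (Γ.snoc A) hA), e.hom ≫ display Γ A hA = f := by
  constructor
  · rintro ⟨_, _, _, ⟨Θ, B, hB⟩, ⟨i⟩⟩
    obtain ⟨t, ht, hti⟩ := exists_hom_eq i.inv.right
    have hBt := ((isCtx_snoc.1 hB).1.substitute hΓ ht).isCtx_snoc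
    have h_iso : IsPullback i.inv.left f (display Θ B hB) i.inv.right :=
      .of_horiz_isIso ⟨Arrow.w i.inv⟩
    rw [← hti] at h_iso
    have h_reindex := isPullback_display hΓ hB ht hBt
    exact ⟨B.sub t, hBt, h_iso.isoIsPullback _ _ h_reindex, h_iso.isoIsPullback_hom_snd _ _ _⟩
  · rintro ⟨A, hA, e, rfl⟩
    exact (MorphismProperty.cancel_left_of_respectsIso _ _ _).2
      (MorphismProperty.le_isoClosure _ _ (.mk Γ A hA))

namespace StrongSums

section Elements

variable (hT : T.StrongSums) {n k : ℕ} {Γ : Ctx T.sig n} {Δ : Ctx T.sig k} {σ : Sub T.sig n k}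
  {A : Ty T.sig n} {B : Ty T.sig (n + 1)} {a b c : Tm T.sig k}

theorem pair_intro_sub (hσ : T.IsSub Δ Γ σ) (hB : T.Derivable (Γ.snoc A) (.isTy B))
    (ha : T.Derivable Δ (.hasTy a (A.sub σ)))
    (hb : T.Derivable Δ (.hasTy b (B.sub (Sub.cons a σ)))) :
    T.Derivable Δ (.hasTy (hT.sym.pair a b) ((hT.sym.sigma A B).sub σ)) := by
  rw [← Expr.sub_lift_inst] at hb
  rw [SumSymbols.sigma_sub]
  exact hT.pair_intro (hB.isTy_of_snoc.substitute ha.isCtx hσ) (hB.substitute_lift ha.isCtx hσ)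
    ha hb

theorem fst_pair_sub (hσ : T.IsSub Δ Γ σ) (hB : T.Derivable (Γ.snoc A) (.isTy B))
    (ha : T.Derivable Δ (.hasTy a (A.sub σ)))
    (hb : T.Derivable Δ (.hasTy b (B.sub (Sub.cons a σ)))) :
    T.Derivable Δ (.tmEq (hT.sym.fst (hT.sym.pair a b)) a (A.sub σ)) := by
  rw [← Expr.sub_lift_inst] at hb
  exact hT.fst_pair (hB.isTy_of_snoc.substitute ha.isCtx hσ) (hB.substitute_lift ha.isCtx hσ)
    ha hb

theorem snd_pair_sub (hσ : T.IsSub Δ Γ σ) (hB : T.Derivable (Γ.snoc A) (.isTy B))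
    (ha : T.Derivable Δ (.hasTy a (A.sub σ)))
    (hb : T.Derivable Δ (.hasTy b (B.sub (Sub.cons a σ)))) :
    T.Derivable Δ (.tmEq (hT.sym.snd (hT.sym.pair a b)) b (B.sub (Sub.cons a σ))) := by
  rw [← Expr.sub_lift_inst] at hb ⊢
  exact hT.snd_pair (hB.isTy_of_snoc.substitute ha.isCtx hσ) (hB.substitute_lift ha.isCtx hσ)
    ha hb

theorem fst_elim_sub (hσ : T.IsSub Δ Γ σ) (hB : T.Derivable (Γ.snoc A) (.isTy B))
    (hc : T.Derivable Δ (.hasTy c ((hT.sym.sigma A B).sub σ))) :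
    T.Derivable Δ (.hasTy (hT.sym.fst c) (A.sub σ)) := by
  rw [SumSymbols.sigma_sub] at hc
  exact hT.fst_elim (hB.isTy_of_snoc.substitute hc.isCtx hσ) (hB.substitute_lift hc.isCtx hσ) hc

theorem snd_elim_sub (hσ : T.IsSub Δ Γ σ) (hB : T.Derivable (Γ.snoc A) (.isTy B))
    (hc : T.Derivable Δ (.hasTy c ((hT.sym.sigma A B).sub σ))) :
    T.Derivable Δ (.hasTy (hT.sym.snd c) (B.sub (Sub.cons (hT.sym.fst c) σ))) := by
  rw [SumSymbols.sigma_sub] at hc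
  rw [← Expr.sub_lift_inst]
  exact hT.snd_elim (hB.isTy_of_snoc.substitute hc.isCtx hσ) (hB.substitute_lift hc.isCtx hσ) hc

theorem pair_eta_sub (hσ : T.IsSub Δ Γ σ) (hB : T.Derivable (Γ.snoc A) (.isTy B))
    (hc : T.Derivable Δ (.hasTy c ((hT.sym.sigma A B).sub σ))) :
    T.Derivable Δ (.tmEq (hT.sym.pair (hT.sym.fst c) (hT.sym.snd c)) c
      ((hT.sym.sigma A B).sub σ)) := by
  rw [SumSymbols.sigma_sub] at hc ⊢
  exact hT.pair_eta (hB.isTy_of_snoc.substitute hc.isCtx hσ) (hB.substitute_lift hc.isCtx hσ) hc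

end Elements

section Contexts

variable (hT : T.StrongSums) {n : ℕ} {Γ : Ctx T.sig n} {A : Ty T.sig n} {B : Ty T.sig (n + 1)}

theorem isIso_display_one (h : T.IsCtx (Γ.snoc (hT.sym.one n))) :
    IsIso (display Γ (hT.sym.one n) h) := by
  obtain ⟨h_one, hΓ⟩ := isCtx_snoc.1 h
  have h_star : T.IsSub Γ (Γ.snoc (hT.sym.one n)) (Sub.cons (hT.sym.star n) (Sub.id n)) := by
    refine isSub_snoc_iff.2 ⟨isSub_id hΓ, ?_⟩
    rw [SumSymbols.one_sub]
    exact hT.star_intro hΓ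
  have h_id := isSub_id h
  refine ⟨hom hΓ h _ h_star, Eq.symm ?_, hom_comp_display h h_star⟩
  refine (hom_eq_hom_iff h_id ((isSub_drop_one h).comp h h_star)).2 (subEq_snoc_iff.2
    ⟨.refl (isSub_drop_one h), ?_⟩)
  have h_var := (isSub_snoc_iff.1 h_id).2
  rw [SumSymbols.one_sub] at h_var ⊢
  rw [Sub.comp_cons, SumSymbols.star_sub]
  exact hT.one_eta h_var

theorem isCtx_snoc_sigma (hB : T.IsCtx ((Γ.snoc A).snoc B)) :
    T.IsCtx (Γ.snoc (hT.sym.sigma A B)) :=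
  have hB_ty := (isCtx_snoc.1 hB).1
  (hT.sigma_form hB_ty.isTy_of_snoc hB_ty).isCtx_snoc

theorem isSub_pairing (hB : T.IsCtx ((Γ.snoc A).snoc B)) :
    T.IsSub ((Γ.snoc A).snoc B) (Γ.snoc (hT.sym.sigma A B)) (hT.sym.pairing n) := by
  obtain ⟨h_tail, h_snd⟩ := isSub_snoc_iff.1 (isSub_id hB)
  obtain ⟨h_drop, h_fst⟩ := isSub_snoc_iff.1 h_tail
  rw [← Sub.cons_zero_tail (Sub.tail _)] at h_snd
  exact isSub_snoc_iff.2 ⟨h_drop, hT.pair_intro_sub h_drop (isCtx_snoc.1 hB).1 h_fst h_snd⟩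

theorem isSub_unpairing (hB : T.IsCtx ((Γ.snoc A).snoc B)) :
    T.IsSub (Γ.snoc (hT.sym.sigma A B)) ((Γ.snoc A).snoc B) (hT.sym.unpairing n) := by
  obtain ⟨h_drop, h_var⟩ := isSub_snoc_iff.1 (isSub_id (hT.isCtx_snoc_sigma hB))
  have hB_ty := (isCtx_snoc.1 hB).1
  exact isSub_snoc_iff.2 ⟨isSub_snoc_iff.2 ⟨h_drop, hT.fst_elim_sub h_drop hB_ty h_var⟩,
    hT.snd_elim_sub h_drop hB_ty h_var⟩

theorem hom_pairing_comp_hom_unpairing (hB : T.IsCtx ((Γ.snoc A).snoc B)) :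
    hom hB (hT.isCtx_snoc_sigma hB) (hT.sym.pairing n) (hT.isSub_pairing hB) ≫
      hom (hT.isCtx_snoc_sigma hB) hB (hT.sym.unpairing n) (hT.isSub_unpairing hB) = 𝟙 _ := by
  have h_id := isSub_id hB
  obtain ⟨h_tail, h_snd⟩ := isSub_snoc_iff.1 h_id
  obtain ⟨h_drop, h_fst⟩ := isSub_snoc_iff.1 h_tail
  have hB_ty := (isCtx_snoc.1 hB).1
  refine Eq.symm ((hom_eq_hom_iff h_id ((hT.isSub_pairing hB).comp hB
    (hT.isSub_unpairing hB))).2 ?_)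
  rw [SumSymbols.pairing_comp_unpairing]
  rw [← Sub.cons_zero_tail (Sub.tail _)] at h_snd
  refine subEq_snoc_iff.2 ⟨subEq_snoc_iff.2 ⟨.refl h_drop,
    (hT.fst_pair_sub h_drop hB_ty h_fst h_snd).tmSymm⟩, ?_⟩
  rw [← Sub.cons_zero_tail (Sub.tail _)]
  exact (hT.snd_pair_sub h_drop hB_ty h_fst h_snd).tmSymm

theorem hom_unpairing_comp_hom_pairing (hB : T.IsCtx ((Γ.snoc A).snoc B)) :
    hom (hT.isCtx_snoc_sigma hB) hB (hT.sym.unpairing n) (hT.isSub_unpairing hB) ≫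
      hom hB (hT.isCtx_snoc_sigma hB) (hT.sym.pairing n) (hT.isSub_pairing hB) = 𝟙 _ := by
  have hS := hT.isCtx_snoc_sigma hB
  have h_id := isSub_id hS
  obtain ⟨h_drop, h_var⟩ := isSub_snoc_iff.1 h_id
  refine (hom_eq_hom_iff ((hT.isSub_unpairing hB).comp hS (hT.isSub_pairing hB)) h_id).2 ?_
  rw [SumSymbols.unpairing_comp_pairing]
  exact subEq_snoc_iff.2 ⟨.refl h_drop, hT.pair_eta_sub h_drop (isCtx_snoc.1 hB).1 h_var⟩

/-- The isomorphism `[Γ, x ∈ A, y ∈ B] ≅ [Γ, z ∈ Σ x ∈ A. B]`. -/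
def sigmaIso (hB : T.IsCtx ((Γ.snoc A).snoc B)) :
    obj ((Γ.snoc A).snoc B) hB ≅ obj (Γ.snoc (hT.sym.sigma A B)) (hT.isCtx_snoc_sigma hB) where
  hom := hom hB (hT.isCtx_snoc_sigma hB) (hT.sym.pairing n) (hT.isSub_pairing hB)
  inv := hom (hT.isCtx_snoc_sigma hB) hB (hT.sym.unpairing n) (hT.isSub_unpairing hB)
  hom_inv_id := hT.hom_pairing_comp_hom_unpairing hB
  inv_hom_id := hT.hom_unpairing_comp_hom_pairing hB

theorem sigmaIso_hom_comp_display (hB : T.IsCtx ((Γ.snoc A).snoc B)) :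
    (hT.sigmaIso hB).hom ≫ display Γ (hT.sym.sigma A B) (hT.isCtx_snoc_sigma hB) =
      display (Γ.snoc A) B hB ≫ display Γ A (isCtx_snoc.1 hB).2 :=
  rfl

end Contexts

theorem isMultiplicative_isoClosure_displayMaps (hT : T.StrongSums) :
    (displayMaps T).isoClosure.IsMultiplicative where
  id_mem X := by
    induction X using ClassifyingCategory.ind with
    | _ Γ hΓ =>
    have h_one := (hT.one_form hΓ).isCtx_snoc
    have := hT.isIso_display_one h_one
    exact isoClosure_displayMaps_iff.2
      ⟨_, h_one, (asIso (display Γ _ h_one)).symm, IsIso.inv_hom_id _⟩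
  comp_mem {X Y Z} f g hf hg := by
    induction Z using ClassifyingCategory.ind with
    | _ Γ hΓ =>
    obtain ⟨A, hA, e, rfl⟩ := isoClosure_displayMaps_iff.1 hg
    have hfe : (displayMaps T).isoClosure (f ≫ e.hom) :=
      (MorphismProperty.cancel_right_of_respectsIso _ f e.hom).2 hf
    obtain ⟨B, hB, e', he'⟩ := isoClosure_displayMaps_iff.1 hfe
    refine isoClosure_displayMaps_iff.2
      ⟨_, hT.isCtx_snoc_sigma hB, e' ≪≫ hT.sigmaIso hB, ?_⟩
    rw [Iso.trans_hom, Category.assoc, sigmaIso_hom_comp_display, ← Category.assoc, he',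
      Category.assoc]

theorem dependentProjections_le_isoClosure_displayMaps (hT : T.StrongSums) :
    dependentProjections T ≤ (displayMaps T).isoClosure := by
  have := hT.isMultiplicative_isoClosure_displayMaps
  rintro _ _ _ ⟨Γ, Δ, h⟩
  induction Δ with
  | nil => exact MorphismProperty.id_mem _ (obj Γ h)
  | snoc Ξ B ih =>
    rw [projection_snoc]
    exact MorphismProperty.comp_mem _ _ _ (MorphismProperty.le_isoClosure _ _ (.mk _ B h))
      (ih (isCtx_snoc.1 h).2)

theorem fibrations_le_isoClosure_displayMaps (hT : T.StrongSums) :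
    fibrations T ≤ (displayMaps T).isoClosure :=
  (MorphismProperty.isoClosure_le_iff _ _).2 hT.dependentProjections_le_isoClosure_displayMaps

end StrongSums

end TypeTheory

theorem mainTheorem11 (T : TypeTheory.{u}) (_hT : T.StrongSums)
    {X Y : T.ClassifyingCategory} (f : X ⟶ Y) (hf : T.fibrations f) :
    ∃ (X' Y' : T.ClassifyingCategory) (g : X' ⟶ Y'),
      T.displayMaps g ∧ Nonempty (Arrow.mk f ≅ Arrow.mk g) := by
  obtain ⟨X', Y', g, hg, ⟨i⟩⟩ := _hT.fibrations_le_isoClosure_displayMaps f hf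
  exact ⟨X', Y', g, hg, ⟨i.symm⟩⟩
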